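/- Let $N\ge 0$ be an integer (for $N=0$ the statement is the trivial identity $1=1$), let $\eta,\delta,\zeta\in\mathbb{C}$, $\lambda_1,\dots,\lambda_N,\xi_1,\dots,\xi_N\in\mathbb{C}$, and put $\theta=\delta-\zeta$. Let $V=\mathbb{C}^2$ with basis (spin up, spin down), $\mathcal H=V_1\otimes\cdots\otimes V_N$ with $V_m\simeq V$, and let $V_0\simeq V$ be an auxiliary space. In the basis $\uparrow\uparrow,\uparrow\downarrow,\downarrow\uparrow,\downarrow\downarrow$ of $V\otimes V$ let $$\mathcal R(\lambda;\theta)=\begin{pmatrix}\sinh(\lambda+\eta)&0&0&0\\0&\frac{\sinh\lambda\,\sinh(\theta-\eta)}{\sinh\theta}&\frac{\sinh\eta\,\sinh(\theta-\lambda)}{\sinh\theta}&0\\0&\frac{\sinh\eta\,\sinh(\theta+\lambda)}{\sinh\theta}&\frac{\sinh\lambda\,\sinh(\theta+\eta)}{\sinh\theta}&0\\0&0&0&\sinh(\lambda+\eta)\end{pmatrix},$$ let $\mathcal R_{0m}$ be its action on $V_0\otimes V_m$ (first factor $V_0$), $\mathcal R_{m0}=P_{0m}\mathcal R_{0m}P_{0m}$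 with $P_{0m}$ the permutation of the two factors, and let $\sigma^z_i$ be the Pauli matrix $\mathrm{diag}(1,-1)$ on $V_i$. Define on $V_0\otimes\mathcal H$ $$\mathcal T_0(\lambda;\theta)=\mathcal R_{01}\Big(\lambda-\xi_1;\theta-\eta\sum_{i=2}^N\sigma^z_i\Big)\cdots\mathcal R_{0N}(\lambda-\xi_N;\theta),$$ $$\widehat{\mathcal T}_0(\lambda;\theta)=\mathcal R_{N0}(\lambda+\xi_N;\theta)\cdots\mathcal R_{10}\Big(\lambda+\xi_1;\theta-\eta\sum_{i=2}^N\sigma^z_i\Big),$$ where the factor with site $m$ has dynamical argument $\theta-\eta\sum_{i>m}\sigma_i^z$. Let $$\mathcal K_-(\lambda)=\mathrm{diag}\Big(\frac{\sinh(\delta-\lambda)}{\sinh(\delta+\lambda)},\frac{\sinh(\zeta-\lambda)}{\sinh(\zeta+\lambda)}\Big)$$ act on $V_0$, and let $\mathcal B_-(\lambda;\theta)\in\operatorname{End}(\mathcal H)$ be the upper right block, with respect to $V_0$, of $\mathcal T_0(\lambda;\theta)\,\mathcal K_-(\lambda)\,\widehat{\mathcal T}_0(\lambda;\theta)$. Let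 $|0\rangle$ be the state of $\mathcal H$ with all spins up and $\langle\bar 0|$ the dual of the state with all spins down. The partition function of the trigonometric SOS model with a left reflecting end and domain wall boundary conditions (upper heights decreasing, lower heights increasing from left to right) is $$Z^{\mathcal B_-}_{N,2N}=\langle\bar 0|\,\mathcal B_-(\lambda_1;\theta)\cdots\mathcal B_-(\lambda_N;\theta)\,|0\rangle,\qquad\theta=\delta-\zeta .$$ Assume that no denominator vanishes, that is, that the following are nonzero: $\sinh(\delta-\zeta+k\eta)$ for all integers $k$ with $|k|<N$; $\sinh(\delta+\lambda_i)$ and $\sinh(\zeta+\lambda_i)$ for all $i$; $\sinh(\lambda_i\pm\xi_j)$ and $\sinh(\lambda_i\pm\xi_j+\eta)$ for all $i,j$; and $\sinh(\xi_j\pm\xi_i)$, $\sinh(\lambda_j-\lambda_i)$, $\sinh(\lambda_j+\lambda_i+\eta)$ for all $i<j$. Then $$Z^{\mathcal B_-}_{N,2N}=(-1)^{N(N-1)/2}\,\det_{1\le i,j\le N}(M_{ij})\;\prod_{i=1}^N\frac{\sinh(\delta-\zeta+\eta(N-2i))}{\sinh(\delta-\zeta+\eta(N-i))}\;\cdot\;\frac{\prod_{i,j=1}^N\sinh(\lambda_i+\xi_j)\sinh(\lambda_i-\xi_j)\sinh(\lambda_i+\xi_j+\eta)\sinh(\lambda_i-\xi_j+\eta)}{\prod_{1\le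 i<j\le N}\sinh(\xi_j+\xi_i)\sinh(\xi_j-\xi_i)\sinh(\lambda_j-\lambda_i)\sinh(\lambda_j+\lambda_i+\eta)},$$ where $$M_{ij}=\frac{\sinh(\delta+\xi_j)}{\sinh(\delta+\lambda_i)}\cdot\frac{\sinh(\zeta-\xi_j)}{\sinh(\zeta+\lambda_i)}\cdot\frac{\sinh(2\lambda_i)\,\sinh\eta}{\sinh(\lambda_i-\xi_j+\eta)\,\sinh(\lambda_i+\xi_j+\eta)\,\sinh(\lambda_i-\xi_j)\,\sinh(\lambda_i+\xi_j)} .$$ -/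

import Mathlib

namespace SOSReflecting

open Complex

noncomputable section

/-- The eigenvalue of `σ^z` on a basis vector of `V = ℂ²`: index `0` is spin up, `1` spin down. -/
def sigmaZ (s : Fin 2) : ℂ := if s = 0 then 1 else -1

/-- The dynamical `R`-matrix `R(l; θ)` on `V ⊗ V`, in the ordered basis
`(0,0), (0,1), (1,0), (1,1)` of the tensor product. -/
def dynR (η l θ : ℂ) : Matrix (Fin 2 × Fin 2) (Fin 2 × Fin 2) ℂ :=
  Matrix.reindex finProdFinEquiv.symm finProdFinEquiv.symm
    !![sinh (l + η), 0, 0, 0;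
       0, sinh l * sinh (θ - η) / sinh θ, sinh η * sinh (θ - l) / sinh θ, 0;
       0, sinh η * sinh (θ + l) / sinh θ, sinh l * sinh (θ + η) / sinh θ, 0;
       0, 0, 0, sinh (l + η)]

/-- Basis of the quantum space `H = V₁ ⊗ ⋯ ⊗ V_N`. -/
abbrev Config (N : ℕ) : Type := Fin N → Fin 2

/-- The height `θ - η ∑_{i > m} σ^z_i`, evaluated on a basis vector of `H`. -/
def height {N : ℕ} (η θ : ℂ) (m : Fin N) (s : Config N) : ℂ :=
  θ - η * ∑ i ∈ Finset.Ioi m, sigmaZ (s i)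

/-- `R_{0m}(l; θ - η ∑_{i > m} σ^z_i)` as an operator on `V₀ ⊗ H`. It acts as the identity on the
sites different from `m`, so that the operators `σ^z_i`, `i > m`, in its argument commute with it
and are diagonal in the chosen basis. -/
def siteR {N : ℕ} (η l θ : ℂ) (m : Fin N) :
    Matrix (Fin 2 × Config N) (Fin 2 × Config N) ℂ :=
  Matrix.of fun p q =>
    if ∀ i, i ≠ m → p.2 i = q.2 i then
      dynR η l (height η θ m q.2) (p.1, p.2 m) (q.1, q.2 m)
    else 0

/-- `R_{m0}(l; θ - η ∑_{i > m} σ^z_i)` as an operator on `V₀ ⊗ H`, where `R_{m0} = P R_{0m} P`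
with the permutation `P` of `V₀` and `V_m`. -/
def siteRHat {N : ℕ} (η l θ : ℂ) (m : Fin N) :
    Matrix (Fin 2 × Config N) (Fin 2 × Config N) ℂ :=
  Matrix.of fun p q =>
    if ∀ i, i ≠ m → p.2 i = q.2 i then
      dynR η l (height η θ m q.2) (p.2 m, p.1) (q.2 m, q.1)
    else 0

/-- The dynamical monodromy matrix
`T₀(l; θ) = R_{01}(l - ξ₁; θ - η ∑_{i ≥ 2} σ^z_i) ⋯ R_{0N}(l - ξ_N; θ)`. -/
def monodromy {N : ℕ} (η : ℂ) (ξ : Fin N → ℂ) (l θ : ℂ) :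
    Matrix (Fin 2 × Config N) (Fin 2 × Config N) ℂ :=
  (List.ofFn fun m : Fin N => siteR η (l - ξ m) θ m).prod

/-- The second monodromy matrix
`R_{N0}(l + ξ_N; θ) ⋯ R_{10}(l + ξ₁; θ - η ∑_{i ≥ 2} σ^z_i)`. -/
def monodromyHat {N : ℕ} (η : ℂ) (ξ : Fin N → ℂ) (l θ : ℂ) :
    Matrix (Fin 2 × Config N) (Fin 2 × Config N) ℂ :=
  (List.ofFn fun m : Fin N => siteRHat η (l + ξ m) θ m).reverse.prod

/-- The diagonal boundary matrix `K_-(l; δ, ζ)` on the auxiliary space. -/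
def boundaryK (δ ζ l : ℂ) : Matrix (Fin 2) (Fin 2) ℂ :=
  !![sinh (δ - l) / sinh (δ + l), 0;
     0, sinh (ζ - l) / sinh (ζ + l)]

/-- The double row monodromy matrix `U_-(l; θ) = T₀(l; θ) K_-(l) T̂₀(l; θ)` on `V₀ ⊗ H`. -/
def doubleRow {N : ℕ} (η δ ζ : ℂ) (ξ : Fin N → ℂ) (l θ : ℂ) :
    Matrix (Fin 2 × Config N) (Fin 2 × Config N) ℂ :=
  monodromy η ξ l θ *
    Matrix.kronecker (boundaryK δ ζ l) (1 : Matrix (Config N) (Config N) ℂ) *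
    monodromyHat η ξ l θ

/-- The operator `B_-(l; θ)` on `H`: the upper right block of `U_-(l; θ)` with respect to `V₀`. -/
def opB {N : ℕ} (η δ ζ : ℂ) (ξ : Fin N → ℂ) (l θ : ℂ) :
    Matrix (Config N) (Config N) ℂ :=
  Matrix.of fun s t => doubleRow η δ ζ ξ l θ (0, s) (1, t)

/-- The partition function `⟨0̄| B_-(l₁; θ) ⋯ B_-(l_N; θ) |0⟩` with `θ = δ - ζ`, where `|0⟩` is the
state with all spins up and `⟨0̄|` the dual of the state with all spins down. -/
def partitionB {N : ℕ} (η δ ζ : ℂ) (l ξ : Fin N → ℂ) : ℂ :=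
  (List.ofFn fun i : Fin N => opB η δ ζ ξ (l i) (δ - ζ)).prod (fun _ => 1) (fun _ => 0)

/-- The matrix `M` of the determinant formula. -/
def detMatrix {N : ℕ} (η δ ζ : ℂ) (l ξ : Fin N → ℂ) : Matrix (Fin N) (Fin N) ℂ :=
  Matrix.of fun i j =>
    sinh (δ + ξ j) / sinh (δ + l i) * (sinh (ζ - ξ j) / sinh (ζ + l i)) *
      (sinh (2 * l i) * sinh η /
        (sinh (l i - ξ j + η) * sinh (l i + ξ j + η) * sinh (l i - ξ j) * sinh (l i + ξ j)))

end

end SOSReflecting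

namespace SOSReflecting

open Complex Finset

/-! The proof follows the Izergin–Korepin scheme: symmetry in the inhomogeneities, polynomiality in
one spectral parameter, a recursion at special points, and interpolation.

After the boundary denominators are cleared, `B(l)` is described by `rowOp`, which adds one site at
a time on the left. Three facts about the resulting partition function carry the argument.

Symmetry (`partitionFn_perm`): the dynamical Yang-Baxter equation gives an intertwiner that
exchanges neighbouring inhomogeneities. The reference vector and covector are eigenvectors of it
with the same eigenvalue, so the partition function is symmetric in the `ξ j`.

Polynomiality (`exists_polynomial_rowOp`): the operator with the last spectral parameter acts
directly on the reference state. On `N + 1` sites every component of the result is `sinh (2 * l)`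
times a polynomial of degree at most `N` in `cosh (2 * l + η)`. The difficult component is a single
down spin: there the `A` and `D` contributions combine into two terms exchanged by the crossing `l ↦
-l - η`, and the special height `θ = δ - ζ` lowers the degree by one.

Freezing (`partitionFn_freeze`): at `l = -ξ 0` only the state with its down spin on the leftmost
site survives. That column is then frozen in all other rows and factors out, which leaves the
partition function of a lattice smaller by one row and one column.

Multiplied by the two Vandermonde products, the claim becomes `ClearedFormula`. With `N + 1` columns
both sides have degree at most `2 * N` in `cosh (2 * z + η)`, up to the factor `sinh (2 * z)`. They
agree at the `N + 1` points `-ξ j` by freezing, symmetry and induction, and both vanish at the `N`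
other spectral parameters (`ClearedFormula.of_interpolation`). Genericity of `ξ` is removed by
continuity (`clearedFormula`), and the constant of the recursion telescopes to the stated product
(`formulaConst_eq`). -/

/-- `∑ i, σ^z_i` on a basis vector. -/
noncomputable def magnetization {N : ℕ} (s : Config N) : ℂ := ∑ i, sigmaZ (s i)

/-! ### The double row operator as a recursion over sites. -/

/-- Double row operator with diagonal boundary weights `κ`, built by adding sites on the left. -/
noncomputable def rowOp (η θ l : ℂ) (κ : Fin 2 → ℂ) :
    (N : ℕ) → (Fin N → ℂ) → Fin 2 → Fin 2 → Matrix (Config N) (Config N) ℂ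
  | 0, _, a, b => Matrix.of fun _ _ => if a = b then κ a else 0
  | N + 1, ξ, a, b => Matrix.of fun s t => ∑ c, ∑ d, ∑ x,
      dynR η (l - ξ 0) (θ - η * magnetization (Fin.tail s)) (a, s 0) (c, x) *
        rowOp η θ l κ N (Fin.tail ξ) c d (Fin.tail s) (Fin.tail t) *
        dynR η (l + ξ 0) (θ - η * magnetization (Fin.tail t)) (x, d) (t 0, b)

/-- Extension of an operator by the identity on a new leftmost site. -/
def liftOp {N : ℕ} (M : Matrix (Fin 2 × Config N) (Fin 2 × Config N) ℂ) :
    Matrix (Fin 2 × Config (N + 1)) (Fin 2 × Config (N + 1)) ℂ :=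
  Matrix.of fun p q => if p.2 0 = q.2 0 then M (p.1, Fin.tail p.2) (q.1, Fin.tail q.2) else 0

theorem sum_config_succ {N : ℕ} (f : Config (N + 1) → ℂ) :
    ∑ u, f u = ∑ x : Fin 2, ∑ v : Config N, f (Fin.cons x v) := by
  rw [← Fintype.sum_prod_type']
  exact (Fintype.sum_equiv (Fin.consEquiv fun _ => Fin 2) _ _ fun _ => rfl).symm

theorem liftOp_mul {N : ℕ} (M M' : Matrix (Fin 2 × Config N) (Fin 2 × Config N) ℂ) :
    liftOp (M * M') = liftOp M * liftOp M' := by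
  ext ⟨a, s⟩ ⟨b, t⟩
  simp only [liftOp, Matrix.mul_apply, Matrix.of_apply, Fintype.sum_prod_type, sum_config_succ,
    Fin.cons_zero, Fin.tail_cons]
  split_ifs with h
  · refine sum_congr rfl fun c _ => ?_
    rw [sum_eq_single (t 0) (fun x _ hx => sum_eq_zero fun v _ => by simp [hx]) (by simp)]
    simp [h]
  · symm
    refine sum_eq_zero fun c _ => sum_eq_zero fun x _ => sum_eq_zero fun v _ => ?_
    by_cases hx : x = t 0
    · simp [show s 0 ≠ x from hx ▸ h]
    · simp [hx]

theorem config_eq_iff {N : ℕ} {s t : Config (N + 1)} :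
    s = t ↔ s 0 = t 0 ∧ Fin.tail s = Fin.tail t := by
  constructor
  · rintro rfl; simp
  · rintro ⟨h, h'⟩; rw [← Fin.cons_self_tail s, ← Fin.cons_self_tail t, h, h']

theorem liftOp_one {N : ℕ} :
    liftOp (1 : Matrix (Fin 2 × Config N) (Fin 2 × Config N) ℂ) = 1 := by
  ext ⟨a, s⟩ ⟨b, t⟩
  simp only [liftOp, Matrix.of_apply, Matrix.one_apply, Prod.mk.injEq, config_eq_iff]
  split_ifs <;> tauto

theorem liftOp_prod {N : ℕ} (L : List (Matrix (Fin 2 × Config N) (Fin 2 × Config N) ℂ)) :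
    liftOp L.prod = (L.map liftOp).prod := by
  induction L with
  | nil => simpa using liftOp_one
  | cons M L ih => simp [liftOp_mul, ih]

theorem magnetization_tail {N : ℕ} (s : Config (N + 1)) :
    ∑ i ∈ Ioi 0, sigmaZ (s i) = magnetization (Fin.tail s) := by
  rw [Fin.Ioi_zero_eq_map, sum_map]; rfl

theorem magnetization_succ {N : ℕ} (s : Config (N + 1)) :
    magnetization s = sigmaZ (s 0) + magnetization (Fin.tail s) := by
  simp [magnetization, Fin.sum_univ_succ, Fin.tail]

theorem height_zero {N : ℕ} (η θ : ℂ) (s : Config (N + 1)) :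
    height η θ 0 s = θ - η * magnetization (Fin.tail s) := by
  rw [height, magnetization_tail]

theorem height_succ {N : ℕ} (η θ : ℂ) (m : Fin N) (s : Config (N + 1)) :
    height η θ m.succ s = height η θ m (Fin.tail s) := by
  rw [height, height, Fin.Ioi_succ, sum_map]; rfl

theorem agree_off_succ_iff {N : ℕ} (m : Fin N) (s t : Config (N + 1)) :
    (∀ i, i ≠ m.succ → s i = t i) ↔
      s 0 = t 0 ∧ ∀ i, i ≠ m → Fin.tail s i = Fin.tail t i := by
  rw [Fin.forall_fin_succ]
  simp [Fin.tail, (Fin.succ_ne_zero _).symm]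

theorem siteR_succ {N : ℕ} (η l θ : ℂ) (m : Fin N) :
    siteR η l θ m.succ = liftOp (siteR η l θ m) := by
  ext ⟨a, s⟩ ⟨b, t⟩
  simp only [siteR, liftOp, Matrix.of_apply, agree_off_succ_iff, height_succ, ite_and]
  rfl

theorem siteRHat_succ {N : ℕ} (η l θ : ℂ) (m : Fin N) :
    siteRHat η l θ m.succ = liftOp (siteRHat η l θ m) := by
  ext ⟨a, s⟩ ⟨b, t⟩
  simp only [siteRHat, liftOp, Matrix.of_apply, agree_off_succ_iff, height_succ, ite_and]
  rfl

theorem monodromy_succ {N : ℕ} (η : ℂ) (ξ : Fin (N + 1) → ℂ) (l θ : ℂ) :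
    monodromy η ξ l θ = siteR η (l - ξ 0) θ 0 * liftOp (monodromy η (Fin.tail ξ) l θ) := by
  simp only [monodromy, List.ofFn_succ, List.prod_cons, liftOp_prod, List.map_ofFn, siteR_succ]
  rfl

theorem monodromyHat_succ {N : ℕ} (η : ℂ) (ξ : Fin (N + 1) → ℂ) (l θ : ℂ) :
    monodromyHat η ξ l θ =
      liftOp (monodromyHat η (Fin.tail ξ) l θ) * siteRHat η (l + ξ 0) θ 0 := by
  simp only [monodromyHat, List.ofFn_succ, List.reverse_cons, List.prod_append, List.prod_singleton,
    liftOp_prod, List.map_reverse, List.map_ofFn, siteRHat_succ]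
  rfl

theorem liftOp_kronecker_one {N : ℕ} (K : Matrix (Fin 2) (Fin 2) ℂ) :
    liftOp (Matrix.kronecker K (1 : Matrix (Config N) (Config N) ℂ)) =
      Matrix.kronecker K (1 : Matrix (Config (N + 1)) (Config (N + 1)) ℂ) := by
  ext ⟨a, s⟩ ⟨b, t⟩
  simp only [liftOp, Matrix.of_apply, Matrix.kronecker, Matrix.kroneckerMap_apply,
    Matrix.one_apply, config_eq_iff]
  split_ifs <;> first | rfl | tauto | simp

theorem doubleRow_succ {N : ℕ} (η δ ζ : ℂ) (ξ : Fin (N + 1) → ℂ) (l θ : ℂ) :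
    doubleRow η δ ζ ξ l θ = siteR η (l - ξ 0) θ 0 * liftOp (doubleRow η δ ζ (Fin.tail ξ) l θ) *
      siteRHat η (l + ξ 0) θ 0 := by
  simp only [doubleRow, monodromy_succ, monodromyHat_succ, liftOp_mul, liftOp_kronecker_one,
    Matrix.mul_assoc]

theorem agree_off_zero_iff {N : ℕ} (s t : Config (N + 1)) :
    (∀ i, i ≠ 0 → s i = t i) ↔ Fin.tail s = Fin.tail t := by
  rw [Fin.forall_fin_succ, funext_iff]
  simp [Fin.tail, Fin.succ_ne_zero]

theorem siteR_zero_mul {N : ℕ} (η l θ : ℂ)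
    (M : Matrix (Fin 2 × Config (N + 1)) (Fin 2 × Config (N + 1)) ℂ) (a : Fin 2)
    (s : Config (N + 1)) (q : Fin 2 × Config (N + 1)) :
    (siteR η l θ (0 : Fin (N + 1)) * M) (a, s) q = ∑ c, ∑ x,
      dynR η l (θ - η * magnetization (Fin.tail s)) (a, s 0) (c, x) *
        M (c, Fin.cons x (Fin.tail s)) q := by
  rw [Matrix.mul_apply, Fintype.sum_prod_type]
  refine sum_congr rfl fun c _ => ?_
  rw [sum_config_succ]
  refine sum_congr rfl fun x _ => ?_
  rw [sum_eq_single (Fin.tail s)]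
  · simp [siteR, agree_off_zero_iff, height_zero]
  · intro v _ hv
    simp [siteR, agree_off_zero_iff, hv.symm]
  · simp

theorem mul_siteRHat_zero {N : ℕ} (η l θ : ℂ)
    (M : Matrix (Fin 2 × Config (N + 1)) (Fin 2 × Config (N + 1)) ℂ) (b : Fin 2)
    (t : Config (N + 1)) (p : Fin 2 × Config (N + 1)) :
    (M * siteRHat η l θ (0 : Fin (N + 1))) p (b, t) = ∑ d, ∑ x,
      M p (d, Fin.cons x (Fin.tail t)) *
        dynR η l (θ - η * magnetization (Fin.tail t)) (x, d) (t 0, b) := by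
  rw [Matrix.mul_apply, Fintype.sum_prod_type]
  refine sum_congr rfl fun c _ => ?_
  rw [sum_config_succ]
  refine sum_congr rfl fun x _ => ?_
  rw [sum_eq_single (Fin.tail t)]
  · simp [siteRHat, agree_off_zero_iff, height_zero]
  · intro v _ hv
    simp [siteRHat, agree_off_zero_iff, hv]
  · simp

/-- The leftmost site is the outermost factor on both sides of the boundary matrix, and the heights
of the other sites do not involve it. Peeling it off therefore leaves the same object on one site
fewer. -/
theorem doubleRow_eq_rowOp {N : ℕ} (η δ ζ : ℂ) (ξ : Fin N → ℂ) (l θ : ℂ) (a b : Fin 2)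
    (s t : Config N) :
    doubleRow η δ ζ ξ l θ (a, s) (b, t) =
      rowOp η θ l (fun c => boundaryK δ ζ l c c) N ξ a b s t := by
  induction N generalizing a b with
  | zero =>
    have h1 : monodromy η ξ l θ = 1 := by simp [monodromy]
    have h2 : monodromyHat η ξ l θ = 1 := by simp [monodromyHat]
    rw [doubleRow, h1, h2, Matrix.one_mul, Matrix.mul_one, Subsingleton.elim s t]
    fin_cases a <;> fin_cases b <;> simp [Matrix.kronecker, boundaryK, rowOp]
  | succ N ih =>
    rw [doubleRow_succ, mul_siteRHat_zero]
    simp only [siteR_zero_mul, rowOp, Matrix.of_apply, liftOp, Fin.cons_zero, Fin.tail_cons, ih]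
    simp only [mul_ite, mul_zero, sum_ite_eq', mem_univ, if_true, sum_mul]
    conv_rhs => rw [sum_comm]
    refine sum_congr rfl fun d _ => ?_
    rw [sum_comm]

/-- The inner boundary weights only enter linearly: they may be rescaled. -/
theorem rowOp_smul (η θ l r : ℂ) (κ : Fin 2 → ℂ) {N : ℕ} (ξ : Fin N → ℂ) (a b : Fin 2) :
    rowOp η θ l (fun c => r * κ c) N ξ a b = r • rowOp η θ l κ N ξ a b := by
  induction N generalizing a b with
  | zero => ext s t; simp [rowOp]
  | succ N ih =>
    ext s t
    simp only [rowOp, ih, Matrix.of_apply, Matrix.smul_apply, smul_eq_mul, mul_sum]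
    refine sum_congr rfl fun c _ => sum_congr rfl fun d _ => sum_congr rfl fun x _ => ?_
    ring

/-! ### Weights of the dynamical R-matrix and spin conservation. -/

theorem sigmaZ_zero : sigmaZ 0 = 1 := rfl

theorem sigmaZ_one : sigmaZ 1 = -1 := rfl

section dynR
variable (η l θ : ℂ)

theorem dynR_up_up_up_up : dynR η l θ (0, 0) (0, 0) = sinh (l + η) := rfl

theorem dynR_down_down_down_down : dynR η l θ (1, 1) (1, 1) = sinh (l + η) := rfl

theorem dynR_up_down_up_down :
    dynR η l θ (0, 1) (0, 1) = sinh l * sinh (θ - η) / sinh θ := rfl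

theorem dynR_up_down_down_up :
    dynR η l θ (0, 1) (1, 0) = sinh η * sinh (θ - l) / sinh θ := rfl

theorem dynR_down_up_up_down :
    dynR η l θ (1, 0) (0, 1) = sinh η * sinh (θ + l) / sinh θ := rfl

theorem dynR_down_up_down_up :
    dynR η l θ (1, 0) (1, 0) = sinh l * sinh (θ + η) / sinh θ := rfl

theorem dynR_eq_zero {p q : Fin 2 × Fin 2}
    (h : sigmaZ p.1 + sigmaZ p.2 ≠ sigmaZ q.1 + sigmaZ q.2) : dynR η l θ p q = 0 := by
  obtain ⟨a, b⟩ := p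
  obtain ⟨c, d⟩ := q
  fin_cases a <;> fin_cases b <;> fin_cases c <;> fin_cases d <;>
    first | rfl | (exfalso; apply h; simp [sigmaZ])

end dynR

/-- The ice rule holds at both vertices of each site and the boundary is diagonal, so the total spin
is conserved. This is what makes heights on the two rows compatible. -/
theorem rowOp_eq_zero (η θ l : ℂ) (κ : Fin 2 → ℂ) {N : ℕ} (ξ : Fin N → ℂ) (a b : Fin 2)
    (s t : Config N)
    (h : sigmaZ a + magnetization s ≠ sigmaZ b + magnetization t) :
    rowOp η θ l κ N ξ a b s t = 0 := by
  induction N generalizing a b with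
  | zero =>
    rw [rowOp, Matrix.of_apply, if_neg]
    rintro rfl
    exact h (by rw [Subsingleton.elim s t])
  | succ N ih =>
    rw [rowOp, Matrix.of_apply]
    refine sum_eq_zero fun c _ => sum_eq_zero fun d _ => sum_eq_zero fun x _ => ?_
    by_cases h1 : sigmaZ a + sigmaZ (s 0) = sigmaZ c + sigmaZ x
    · by_cases h2 : sigmaZ x + sigmaZ d = sigmaZ (t 0) + sigmaZ b
      · rw [ih, mul_zero, zero_mul]
        intro h3
        apply h
        rw [magnetization_succ, magnetization_succ]
        linear_combination h1 + h2 + h3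
      · rw [dynR_eq_zero _ _ _ (p := (x, d)) h2, mul_zero]
    · rw [dynR_eq_zero _ _ _ (p := (a, s 0)) h1, zero_mul, zero_mul]

/-! ### Yang-Baxter relations and symmetry in the inhomogeneities. -/

/-- Intertwiner exchanging two neighbouring sites. -/
noncomputable def exchange (η x h : ℂ) : Matrix (Fin 2 × Fin 2) (Fin 2 × Fin 2) ℂ :=
  Matrix.of fun s p => dynR η x h s p.swap

/-- The auxiliary line crossing two neighbouring sites. -/
noncomputable def pairT (η x₀ x₁ h : ℂ) (a e : Fin 2) :
    Matrix (Fin 2 × Fin 2) (Fin 2 × Fin 2) ℂ :=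
  Matrix.of fun s y => ∑ c,
    dynR η x₀ (h - η * sigmaZ s.2) (a, s.1) (c, y.1) * dynR η x₁ h (c, s.2) (e, y.2)

/-- The reflected auxiliary line crossing two neighbouring sites. -/
noncomputable def pairTHat (η x₀ x₁ h : ℂ) (f b : Fin 2) :
    Matrix (Fin 2 × Fin 2) (Fin 2 × Fin 2) ℂ :=
  Matrix.of fun y t => ∑ d,
    dynR η x₁ h (y.2, f) (t.2, d) * dynR η x₀ (h - η * sigmaZ t.2) (y.1, d) (t.1, b)

theorem sinh_eq_exp_div (z : ℂ) : sinh z = (exp z - 1 / exp z) / 2 := by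
  rw [sinh, exp_neg, one_div]

theorem dynR_entries (η l θ : ℂ) :
    dynR η l θ (0, 0) (0, 1) = 0 ∧ dynR η l θ (0, 0) (1, 0) = 0 ∧ dynR η l θ (0, 0) (1, 1) = 0 ∧
    dynR η l θ (0, 1) (0, 0) = 0 ∧ dynR η l θ (0, 1) (1, 1) = 0 ∧
    dynR η l θ (1, 0) (0, 0) = 0 ∧ dynR η l θ (1, 0) (1, 1) = 0 ∧
    dynR η l θ (1, 1) (0, 0) = 0 ∧ dynR η l θ (1, 1) (0, 1) = 0 ∧ dynR η l θ (1, 1) (1, 0) = 0 :=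
  ⟨rfl, rfl, rfl, rfl, rfl, rfl, rfl, rfl, rfl, rfl⟩

set_option maxHeartbeats 2000000 in
/-- Dynamical Yang-Baxter equation for two sites crossed by the auxiliary line. -/
theorem exchange_mul_pairT (η x₀ x₁ h : ℂ) (a e : Fin 2) (h₀ : sinh h ≠ 0)
    (h₁ : sinh (h + η) ≠ 0) (h₂ : sinh (h - η) ≠ 0) :
    exchange η (x₁ - x₀) h * pairT η x₁ x₀ h a e =
      pairT η x₀ x₁ h a e * exchange η (x₁ - x₀) (h - η * sigmaZ e) := by
  ext ⟨s₀, s₁⟩ ⟨t₀, t₁⟩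
  simp only [exchange, pairT, Matrix.mul_apply, Fintype.sum_prod_type, Fin.sum_univ_two,
    Matrix.of_apply, Prod.swap_prod_mk, sigmaZ_zero, sigmaZ_one, mul_one, mul_neg, sub_neg_eq_add]
  revert a e s₀ s₁ t₀ t₁
  simp only [Fin.forall_fin_two, sigmaZ_zero, sigmaZ_one, mul_one, mul_neg, sub_neg_eq_add]
  simp only [dynR_entries, zero_mul, mul_zero, add_zero, zero_add, true_and, and_true,
    dynR_up_up_up_up, dynR_down_down_down_down, dynR_up_down_up_down, dynR_up_down_down_up,
    dynR_down_up_up_down, dynR_down_up_down_up]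
  have e₁ : h + η - η = h := by ring
  have e₂ : h - η + η = h := by ring
  simp only [e₁, e₂]
  repeat' apply And.intro
  -- Each remaining matrix entry is a rational identity in exponentials, checked after expanding
  -- `sinh`.
  all_goals
    field_simp
    try simp only [sinh_eq_exp_div, exp_add, exp_sub]
    try field_simp
    try ring

set_option maxHeartbeats 2000000 in
/-- Dynamical Yang-Baxter equation for two sites crossed by the reflected auxiliary line. -/
theorem exchange_mul_pairTHat (η x₀ x₁ h : ℂ) (f b : Fin 2) (h₀ : sinh h ≠ 0)
    (h₁ : sinh (h + η) ≠ 0) (h₂ : sinh (h - η) ≠ 0) :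
    exchange η (x₀ - x₁) (h - η * sigmaZ f) * pairTHat η x₁ x₀ h f b =
      pairTHat η x₀ x₁ h f b * exchange η (x₀ - x₁) h := by
  ext ⟨s₀, s₁⟩ ⟨t₀, t₁⟩
  simp only [exchange, pairTHat, Matrix.mul_apply, Fintype.sum_prod_type, Fin.sum_univ_two,
    Matrix.of_apply, Prod.swap_prod_mk, sigmaZ_zero, sigmaZ_one, mul_one, mul_neg, sub_neg_eq_add]
  revert f b s₀ s₁ t₀ t₁
  simp only [Fin.forall_fin_two, sigmaZ_zero, sigmaZ_one, mul_one, mul_neg, sub_neg_eq_add]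
  simp only [dynR_entries, zero_mul, mul_zero, add_zero, zero_add, true_and, and_true,
    dynR_up_up_up_up, dynR_down_down_down_down, dynR_up_down_up_down, dynR_up_down_down_up,
    dynR_down_up_up_down, dynR_down_up_down_up]
  have e₁ : h + η - η = h := by ring
  have e₂ : h - η + η = h := by ring
  simp only [e₁, e₂]
  repeat' apply And.intro
  all_goals
    field_simp
    try simp only [sinh_eq_exp_div, exp_add, exp_sub]
    try field_simp
    try ring

/-- The other sites enter only as scalar coefficients, so an exchange of the two leftmost sites
becomes a statement about 4 by 4 matrices. -/
theorem rowOp_succ_succ (η θ l : ℂ) (κ : Fin 2 → ℂ) {N : ℕ} (ξ : Fin (N + 2) → ℂ) (a b : Fin 2)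
    (s t : Config (N + 2)) :
    rowOp η θ l κ (N + 2) ξ a b s t = ∑ e, ∑ f,
      rowOp η θ l κ N (Fin.tail (Fin.tail ξ)) e f (Fin.tail (Fin.tail s)) (Fin.tail (Fin.tail t)) *
      (pairT η (l - ξ 0) (l - ξ 1) (θ - η * magnetization (Fin.tail (Fin.tail s))) a e *
        pairTHat η (l + ξ 0) (l + ξ 1) (θ - η * magnetization (Fin.tail (Fin.tail t))) f b)
        (s 0, s 1) (t 0, t 1) := by
  have e₁ : ∀ s : Config (N + 2), θ - η * magnetization (Fin.tail s) =
      θ - η * magnetization (Fin.tail (Fin.tail s)) - η * sigmaZ (s 1) := by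
    intro s
    rw [magnetization_succ (Fin.tail s)]
    simp only [Fin.tail, Fin.succ_zero_eq_one]
    ring
  have e₂ : ∀ s : Config (N + 2), Fin.tail s 0 = s 1 := fun s => rfl
  have e₃ : Fin.tail ξ 0 = ξ 1 := rfl
  rw [rowOp]
  simp only [Matrix.of_apply, e₁ s, e₁ t]
  simp only [rowOp, Matrix.of_apply, e₂, e₃, pairT, pairTHat, Matrix.mul_apply,
    Fintype.sum_prod_type, Fin.sum_univ_two]
  ring

/-- `S` intertwines the double row operators with inhomogeneities `ξ'` and `ξ` and has the
reference states as eigenvectors. -/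
structure Intertwines (η θ : ℂ) {N : ℕ} (ξ ξ' : Fin N → ℂ)
    (S : Matrix (Config N) (Config N) ℂ) (k : ℂ) : Prop where
  comm : ∀ l κ a b, S * rowOp η θ l κ N ξ' a b = rowOp η θ l κ N ξ a b * S
  conserve : ∀ s t, magnetization s ≠ magnetization t → S s t = 0
  down : ∀ t, S (fun _ => 1) t = if t = fun _ => 1 then k else 0
  up : ∀ s, S s (fun _ => 0) = if s = fun _ => 0 then k else 0

theorem tail_const {N : ℕ} (x : Fin 2) : (Fin.tail fun _ : Fin (N + 1) => x) = fun _ => x := rfl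

/-- The weights at the new site see the other sites only through their magnetization. Since `S`
preserves it, these weights can be moved past `S`. -/
theorem Intertwines.cons {η θ : ℂ} {N : ℕ} {ξ ξ' : Fin (N + 1) → ℂ}
    {S : Matrix (Config N) (Config N) ℂ} {k : ℂ}
    (h : Intertwines η θ (Fin.tail ξ) (Fin.tail ξ') S k) (h0 : ξ' 0 = ξ 0) :
    Intertwines η θ ξ ξ'
      (Matrix.of fun s t => if s 0 = t 0 then S (Fin.tail s) (Fin.tail t) else 0) k where
  comm l κ a b := by
    ext s t
    simp only [Matrix.mul_apply, sum_config_succ, Matrix.of_apply, Fin.cons_zero, Fin.tail_cons,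
      rowOp, h0]
    rw [sum_eq_single (s 0) (fun x _ hx => sum_eq_zero fun v _ => by simp [hx.symm]) (by simp)]
    rw [sum_eq_single (t 0) (fun x _ hx => sum_eq_zero fun v _ => by simp [hx]) (by simp)]
    simp only [if_true, mul_sum, sum_mul]
    rw [sum_comm]
    conv_rhs => rw [sum_comm]
    refine sum_congr rfl fun c _ => ?_
    rw [sum_comm]
    conv_rhs => rw [sum_comm]
    refine sum_congr rfl fun d _ => ?_
    rw [sum_comm]
    conv_rhs => rw [sum_comm]
    refine sum_congr rfl fun x _ => ?_
    have key := congrFun (congrFun (h.comm l κ c d) (Fin.tail s)) (Fin.tail t)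
    simp only [Matrix.mul_apply] at key
    have h1 : ∀ v, S (Fin.tail s) v *
        (dynR η (l - ξ 0) (θ - η * magnetization v) (a, s 0) (c, x) *
          rowOp η θ l κ N (Fin.tail ξ') c d v (Fin.tail t) *
          dynR η (l + ξ 0) (θ - η * magnetization (Fin.tail t)) (x, d) (t 0, b)) =
        dynR η (l - ξ 0) (θ - η * magnetization (Fin.tail s)) (a, s 0) (c, x) *
          (S (Fin.tail s) v * rowOp η θ l κ N (Fin.tail ξ') c d v (Fin.tail t)) *
          dynR η (l + ξ 0) (θ - η * magnetization (Fin.tail t)) (x, d) (t 0, b) := by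
      intro v
      by_cases hv : magnetization (Fin.tail s) = magnetization v
      · rw [hv]; ring
      · rw [h.conserve _ _ hv]; ring
    have h2 : ∀ v, dynR η (l - ξ 0) (θ - η * magnetization (Fin.tail s)) (a, s 0) (c, x) *
          rowOp η θ l κ N (Fin.tail ξ) c d (Fin.tail s) v *
          dynR η (l + ξ 0) (θ - η * magnetization v) (x, d) (t 0, b) * S v (Fin.tail t) =
        dynR η (l - ξ 0) (θ - η * magnetization (Fin.tail s)) (a, s 0) (c, x) *
          (rowOp η θ l κ N (Fin.tail ξ) c d (Fin.tail s) v * S v (Fin.tail t)) *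
          dynR η (l + ξ 0) (θ - η * magnetization (Fin.tail t)) (x, d) (t 0, b) := by
      intro v
      by_cases hv : magnetization v = magnetization (Fin.tail t)
      · rw [hv]; ring
      · rw [h.conserve _ _ hv]; ring
    rw [sum_congr rfl fun v _ => h1 v, sum_congr rfl fun v _ => h2 v]
    simp only [← sum_mul, ← mul_sum, key]
  conserve s t hst := by
    rw [Matrix.of_apply]
    split_ifs with hx
    · apply h.conserve
      intro h'
      exact hst (by rw [magnetization_succ, magnetization_succ, hx, h'])
    · rfl
  down t := by
    simp only [Matrix.of_apply, tail_const, h.down, config_eq_iff, ite_and, eq_comm]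
  up s := by
    simp only [Matrix.of_apply, tail_const, h.up, config_eq_iff, ite_and]

/-- The operator exchanging the two leftmost sites. -/
noncomputable def exchangeOp (η θ x : ℂ) (N : ℕ) : Matrix (Config (N + 2)) (Config (N + 2)) ℂ :=
  Matrix.of fun s t => if Fin.tail (Fin.tail s) = Fin.tail (Fin.tail t) then
    exchange η x (θ - η * magnetization (Fin.tail (Fin.tail s))) (s 0, s 1) (t 0, t 1) else 0

theorem sum_config_succ_succ {N : ℕ} (f : Config (N + 2) → ℂ) :
    ∑ u, f u = ∑ p : Fin 2 × Fin 2, ∑ v : Config N, f (Fin.cons p.1 (Fin.cons p.2 v)) := by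
  rw [sum_config_succ, Fintype.sum_prod_type]
  exact sum_congr rfl fun x _ => sum_config_succ _

/-- Integrality and the bound reduce nonvanishing at all heights to the finitely many conditions in
`RegularHeights`. -/
theorem magnetization_int {N : ℕ} (s : Config N) :
    ∃ k : ℤ, |k| ≤ N ∧ magnetization s = k := by
  induction N with
  | zero => exact ⟨0, by simp, by simp [magnetization]⟩
  | succ N ih =>
    obtain ⟨k, hk, hs⟩ := ih (Fin.tail s)
    have : ∃ j : ℤ, |j| ≤ 1 ∧ sigmaZ (s 0) = j := by
      generalize s 0 = x
      fin_cases x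
      · exact ⟨1, by simp, by simp [sigmaZ]⟩
      · exact ⟨-1, by simp, by simp [sigmaZ]⟩
    obtain ⟨j, hj, hs0⟩ := this
    refine ⟨j + k, ?_, by rw [magnetization_succ, hs, hs0]; push_cast; rfl⟩
    have := abs_add_le j k
    push_cast
    linarith

/-- The heights that occur in a lattice with `N` columns are not zeros of `sinh`. -/
def RegularHeights (η θ : ℂ) (N : ℕ) : Prop :=
  ∀ k : ℤ, |k| < (N : ℤ) → sinh (θ + η * (k : ℂ)) ≠ 0

theorem RegularHeights.mono {η θ : ℂ} {M N : ℕ} (h : RegularHeights η θ N) (hMN : M ≤ N) :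
    RegularHeights η θ M :=
  fun k hk => h k (hk.trans_le (by exact_mod_cast hMN))

theorem RegularHeights.sinh_ne {η θ : ℂ} {N : ℕ} (h : RegularHeights η θ (N + 2))
    (s : Config N) : sinh (θ - η * magnetization s) ≠ 0 ∧
      sinh (θ - η * magnetization s + η) ≠ 0 ∧ sinh (θ - η * magnetization s - η) ≠ 0 := by
  obtain ⟨k, hk, hs⟩ := magnetization_int s
  rw [hs]
  rw [abs_le] at hk
  refine ⟨?_, ?_, ?_⟩
  · convert h (-k) (by rw [abs_lt]; push_cast; omega) using 2
    push_cast; ring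
  · convert h (-k + 1) (by rw [abs_lt]; push_cast; omega) using 2
    push_cast; ring
  · convert h (-k - 1) (by rw [abs_lt]; push_cast; omega) using 2
    push_cast; ring

theorem intertwines_exchangeOp {η θ : ℂ} {N : ℕ} (hθ : RegularHeights η θ (N + 2))
    {ξ ξ' : Fin (N + 2) → ℂ} (h0 : ξ' 0 = ξ 1) (h1 : ξ' 1 = ξ 0)
    (ht : Fin.tail (Fin.tail ξ') = Fin.tail (Fin.tail ξ)) :
    Intertwines η θ ξ ξ' (exchangeOp η θ (ξ 0 - ξ 1) N) (sinh (ξ 0 - ξ 1 + η)) where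
  comm l κ a b := by
    ext s t
    rw [Matrix.mul_apply, Matrix.mul_apply]
    simp only [sum_config_succ_succ, exchangeOp, Matrix.of_apply,
      Fin.cons_zero, Fin.cons_one, Fin.tail_cons, rowOp_succ_succ, h0, h1, ht, ite_mul, mul_ite,
      zero_mul, mul_zero, sum_ite_eq, sum_ite_eq', mem_univ, if_true]
    set s' := Fin.tail (Fin.tail s)
    set t' := Fin.tail (Fin.tail t)
    obtain ⟨hs₀, hs₁, hs₂⟩ := hθ.sinh_ne s'
    obtain ⟨ht₀, ht₁, ht₂⟩ := hθ.sinh_ne t'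
    simp only [mul_sum, sum_mul]
    rw [sum_comm]
    conv_rhs => rw [sum_comm]
    refine sum_congr rfl fun e _ => ?_
    rw [sum_comm]
    conv_rhs => rw [sum_comm]
    refine sum_congr rfl fun f _ => ?_
    -- The relation for `pairT` releases the intertwiner at height `θ - η M(s') - η σ_e`, while the
    -- one for `pairTHat` needs it at `θ - η M(t') - η σ_f`. Spin conservation on the inner sites
    -- makes these equal; otherwise the inner matrix element vanishes.
    by_cases hc : sigmaZ e + magnetization s' = sigmaZ f + magnetization t'
    · have y₁ := exchange_mul_pairT η (l - ξ 0) (l - ξ 1) (θ - η * magnetization s') a e hs₀ hs₁ hs₂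
      have y₂ :=
        exchange_mul_pairTHat η (l + ξ 0) (l + ξ 1) (θ - η * magnetization t') f b ht₀ ht₁ ht₂
      have x₁ : l - ξ 1 - (l - ξ 0) = ξ 0 - ξ 1 := by ring
      have x₂ : l + ξ 0 - (l + ξ 1) = ξ 0 - ξ 1 := by ring
      have hh : θ - η * magnetization s' - η * sigmaZ e =
          θ - η * magnetization t' - η * sigmaZ f := by linear_combination -η * hc
      rw [x₁, hh] at y₁
      rw [x₂] at y₂
      have key : exchange η (ξ 0 - ξ 1) (θ - η * magnetization s') *
          (pairT η (l - ξ 1) (l - ξ 0) (θ - η * magnetization s') a e *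
            pairTHat η (l + ξ 1) (l + ξ 0) (θ - η * magnetization t') f b) =
          (pairT η (l - ξ 0) (l - ξ 1) (θ - η * magnetization s') a e *
            pairTHat η (l + ξ 0) (l + ξ 1) (θ - η * magnetization t') f b) *
          exchange η (ξ 0 - ξ 1) (θ - η * magnetization t') := by
        rw [← Matrix.mul_assoc, y₁, Matrix.mul_assoc, y₂, Matrix.mul_assoc]
      have key' := congrFun (congrFun key (s 0, s 1)) (t 0, t 1)
      rw [Matrix.mul_apply, Matrix.mul_apply (M := _ * _)] at key'
      calc _ = rowOp η θ l κ N (Fin.tail (Fin.tail ξ)) e f s' t' * _ := by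
            rw [mul_sum]
            exact sum_congr rfl fun p _ => mul_left_comm _ _ _
        _ = _ := by
            rw [key', mul_sum]
            exact sum_congr rfl fun p _ => (mul_assoc _ _ _).symm
    · simp [rowOp_eq_zero η θ l κ _ e f s' t' hc]
  conserve s t hst := by
    rw [exchangeOp, Matrix.of_apply]
    split_ifs with hx
    · apply dynR_eq_zero
      intro h'
      apply hst
      rw [magnetization_succ, magnetization_succ (Fin.tail s), magnetization_succ t,
        magnetization_succ (Fin.tail t), hx]
      simp only [Prod.swap] at h'
      change sigmaZ (s 0) + (sigmaZ (s 1) + _) = sigmaZ (t 0) + (sigmaZ (t 1) + _)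
      linear_combination h'
    · rfl
  down t := by
    have e : exchange η (ξ 0 - ξ 1) (θ - η * magnetization fun _ : Fin N => 1) (1, 1) (t 0, t 1) =
        if t 0 = 1 ∧ t 1 = 1 then sinh (ξ 0 - ξ 1 + η) else 0 := by
      generalize t 0 = x, t 1 = y
      fin_cases x <;> fin_cases y <;> simp [exchange, dynR_entries, dynR_down_down_down_down]
    have i : t = (fun _ => 1) ↔
        (fun _ : Fin N => 1) = Fin.tail (Fin.tail t) ∧ t 0 = 1 ∧ t 1 = 1 := by
      rw [config_eq_iff, config_eq_iff]
      simp only [tail_const, eq_comm, Fin.tail, Fin.succ_zero_eq_one]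
      tauto
    simp only [exchangeOp, Matrix.of_apply, tail_const, e, i, ite_and]
  up s := by
    have e : ∀ h, exchange η (ξ 0 - ξ 1) h (s 0, s 1) (0, 0) =
        if s 0 = 0 ∧ s 1 = 0 then sinh (ξ 0 - ξ 1 + η) else 0 := by
      intro h
      generalize s 0 = x, s 1 = y
      fin_cases x <;> fin_cases y <;> simp [exchange, dynR_entries, dynR_up_up_up_up]
    have i : s = (fun _ => 0) ↔
        Fin.tail (Fin.tail s) = (fun _ : Fin N => 0) ∧ s 0 = 0 ∧ s 1 = 0 := by
      rw [config_eq_iff, config_eq_iff]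
      simp only [tail_const, Fin.tail, Fin.succ_zero_eq_one]
      tauto
    simp only [exchangeOp, Matrix.of_apply, tail_const, e, i, ite_and]

theorem RegularHeights.exists_intertwines {η θ : ℂ} {N : ℕ} (hθ : RegularHeights η θ (N + 1))
    (ξ : Fin (N + 1) → ℂ) (i : Fin N) :
    ∃ S, Intertwines η θ ξ (ξ ∘ Equiv.swap i.castSucc i.succ) S
      (sinh (ξ i.castSucc - ξ i.succ + η)) := by
  induction N with
  | zero => exact i.elim0
  | succ N ih =>
    induction i using Fin.cases with
    | zero =>
      refine ⟨_, intertwines_exchangeOp hθ ?_ ?_ ?_⟩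
      · simp
      · simp
      · ext j
        simp only [Fin.tail, Function.comp_apply]
        rw [Equiv.swap_apply_of_ne_of_ne]
        · simp
        · simp [Fin.ext_iff]
    | succ i =>
      obtain ⟨S, hS⟩ := ih (hθ.mono (by omega)) (Fin.tail ξ) i
      refine ⟨_, Intertwines.cons (S := S) ?_ ?_⟩
      · convert hS using 1
        · ext j
          simp only [Fin.tail, Function.comp_apply]
          congr 1
          rw [Equiv.swap_apply_def, Equiv.swap_apply_def]
          split_ifs <;> simp_all [Fin.ext_iff]
        · rfl
      · simp only [Function.comp_apply]
        rw [Equiv.swap_apply_of_ne_of_ne]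
        · simp [Fin.ext_iff]
        · simp [Fin.ext_iff]

/-- The product of the operators `B` with diagonal boundary weights `κ`; its matrix elements are
partition functions. -/
noncomputable def partitionFn (η θ : ℂ) (κ : ℂ → Fin 2 → ℂ) {M N : ℕ} (l : Fin M → ℂ)
    (ξ : Fin N → ℂ) : Matrix (Config N) (Config N) ℂ :=
  (List.ofFn fun i => rowOp η θ (l i) (κ (l i)) N ξ 0 1).prod

/-- Sandwiching the intertwining relation between the two reference states yields the same scalar
`k` on both sides, and it cancels. -/
theorem Intertwines.partitionFn_eq {η θ : ℂ} {N : ℕ} {ξ ξ' : Fin N → ℂ}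
    {S : Matrix (Config N) (Config N) ℂ} {k : ℂ} (h : Intertwines η θ ξ ξ' S k) (hk : k ≠ 0)
    (κ : ℂ → Fin 2 → ℂ) {M : ℕ} (l : Fin M → ℂ) :
    partitionFn η θ κ l ξ' (fun _ => 1) (fun _ => 0) =
      partitionFn η θ κ l ξ (fun _ => 1) (fun _ => 0) := by
  have comm : S * partitionFn η θ κ l ξ' = partitionFn η θ κ l ξ * S := by
    induction M with
    | zero => simp [partitionFn]
    | succ M ih =>
      have := ih (fun i => l i.succ)
      simp only [partitionFn, List.ofFn_succ, List.prod_cons] at this ⊢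
      rw [← Matrix.mul_assoc, h.comm, Matrix.mul_assoc, this, Matrix.mul_assoc]
  have := congrFun (congrFun comm fun _ => 1) fun _ => 0
  simp only [Matrix.mul_apply, h.down, h.up, ite_mul, mul_ite, zero_mul, mul_zero, sum_ite_eq',
    mem_univ, if_true] at this
  rw [mul_comm] at this
  exact mul_right_cancel₀ hk this

/-- Adjacent transpositions generate the symmetric group. Any two inhomogeneities may become
neighbours along the way, hence the condition on all ordered pairs. -/
theorem partitionFn_perm {η θ : ℂ} {N : ℕ} (hθ : RegularHeights η θ N) (κ : ℂ → Fin 2 → ℂ)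
    {M : ℕ} (l : Fin M → ℂ) (ξ : Fin N → ℂ) (hξ : ∀ i j, i ≠ j → sinh (ξ i - ξ j + η) ≠ 0)
    (σ : Equiv.Perm (Fin N)) :
    partitionFn η θ κ l (ξ ∘ σ) (fun _ => 1) (fun _ => 0) =
      partitionFn η θ κ l ξ (fun _ => 1) (fun _ => 0) := by
  cases N with
  | zero => rw [Subsingleton.elim (ξ ∘ σ) ξ]
  | succ N =>
    have hσ : σ ∈ Submonoid.closure
        (Set.range fun i : Fin N => Equiv.swap i.castSucc i.succ) := by
      rw [Equiv.Perm.mclosure_swap_castSucc_succ]; trivial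
    induction hσ using Submonoid.closure_induction_right with
    | one => rfl
    | mul_right τ _ ρ hρ ih =>
      obtain ⟨i, rfl⟩ := hρ
      obtain ⟨S, hS⟩ := hθ.exists_intertwines (ξ ∘ τ) i
      rw [← ih, ← hS.partitionFn_eq _ κ l]
      · rfl
      · exact hξ _ _ fun h => (Fin.castSucc_lt_succ (i := i)).ne (τ.injective h)

/-! ### Action of the double row operators on the reference state. -/

theorem magnetization_const_zero (N : ℕ) : magnetization (fun _ : Fin N => 0) = N := by
  simp [magnetization, sigmaZ]

/-- Eigenvalue of the diagonal operator entry `A` on the reference state. -/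
noncomputable def upEigenvalue (η l : ℂ) (κ : Fin 2 → ℂ) {N : ℕ} (ξ : Fin N → ℂ) : ℂ :=
  κ 0 * ∏ i, sinh (l - ξ i + η) * sinh (l + ξ i + η)

/-- Eigenvalue of the diagonal operator entry `D` on the reference state. -/
noncomputable def downEigenvalue (η θ l : ℂ) (κ : Fin 2 → ℂ) : (N : ℕ) → (Fin N → ℂ) → ℂ
  | 0, _ => κ 1
  | N + 1, ξ =>
    sinh (l - ξ 0) * sinh (θ - η * N + η) / sinh (θ - η * N) *
        downEigenvalue η θ l κ N (Fin.tail ξ) *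
        (sinh (l + ξ 0) * sinh (θ - η * N - η) / sinh (θ - η * N)) +
      sinh η * sinh (θ - η * N + (l - ξ 0)) / sinh (θ - η * N) *
        upEigenvalue η l κ (Fin.tail ξ) *
        (sinh η * sinh (θ - η * N + (l + ξ 0)) / sinh (θ - η * N))

/-- The entry `C` annihilates the reference state: it would raise a magnetization that is already
maximal. -/
theorem rowOp_one_zero_up (η θ l : ℂ) (κ : Fin 2 → ℂ) {N : ℕ} (ξ : Fin N → ℂ) (s : Config N) :
    rowOp η θ l κ N ξ 1 0 s (fun _ => 0) = 0 := by
  apply rowOp_eq_zero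
  rw [magnetization_const_zero]
  obtain ⟨k, hk, hs⟩ := magnetization_int s
  rw [hs, sigmaZ_zero, sigmaZ_one]
  intro h
  have h' : -1 + k = 1 + (N : ℤ) := by exact_mod_cast h
  have := abs_le.1 hk
  omega

theorem upEigenvalue_succ (η l : ℂ) (κ : Fin 2 → ℂ) {N : ℕ} (ξ : Fin (N + 1) → ℂ) :
    upEigenvalue η l κ ξ =
      sinh (l - ξ 0 + η) * upEigenvalue η l κ (Fin.tail ξ) * sinh (l + ξ 0 + η) := by
  simp only [upEigenvalue, Fin.prod_univ_succ, Fin.tail]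
  ring

theorem rowOp_zero_zero_up (η θ l : ℂ) (κ : Fin 2 → ℂ) {N : ℕ} (ξ : Fin N → ℂ) (s : Config N) :
    rowOp η θ l κ N ξ 0 0 s (fun _ => 0) =
      if s = fun _ => 0 then upEigenvalue η l κ ξ else 0 := by
  induction N with
  | zero => simp [rowOp, upEigenvalue, eq_iff_true_of_subsingleton]
  | succ N ih =>
    rw [upEigenvalue_succ]
    simp only [rowOp, Matrix.of_apply, Fin.sum_univ_two, tail_const, dynR_entries, ih,
      rowOp_one_zero_up, config_eq_iff (s := s), dynR_up_up_up_up]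
    generalize s 0 = x
    fin_cases x
    · simp [dynR_up_up_up_up]
    · simp [dynR_entries]

theorem rowOp_one_one_up (η θ l : ℂ) (κ : Fin 2 → ℂ) {N : ℕ} (ξ : Fin N → ℂ) (s : Config N) :
    rowOp η θ l κ N ξ 1 1 s (fun _ => 0) =
      if s = fun _ => 0 then downEigenvalue η θ l κ N ξ else 0 := by
  induction N with
  | zero => simp [rowOp, downEigenvalue, eq_iff_true_of_subsingleton]
  | succ N ih =>
    simp only [rowOp, downEigenvalue, Matrix.of_apply, Fin.sum_univ_two, tail_const, dynR_entries,
      ih, rowOp_one_zero_up, rowOp_zero_zero_up, config_eq_iff (s := s),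
      magnetization_const_zero]
    generalize s 0 = x
    fin_cases x
    · by_cases h : Fin.tail s = fun _ => 0
      · simp [dynR_entries, dynR_down_up_down_up, dynR_up_down_up_down, dynR_down_up_up_down, h,
          magnetization_const_zero]
        ring
      · simp [dynR_entries, h]
    · simp [dynR_entries]

/-- `B` turns over exactly one spin. Either it lies further right, which gives the recursion, or it
is the leftmost one and the remaining sites contribute the `A` and `D` eigenvalues. -/
theorem rowOp_zero_one_up (η θ l : ℂ) (κ : Fin 2 → ℂ) {N : ℕ} (ξ : Fin (N + 1) → ℂ)
    (s : Config (N + 1)) :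
    rowOp η θ l κ (N + 1) ξ 0 1 s (fun _ => 0) =
      if s 0 = 0 then
        sinh (l - ξ 0 + η) * rowOp η θ l κ N (Fin.tail ξ) 0 1 (Fin.tail s) (fun _ => 0) *
          (sinh (l + ξ 0) * sinh (θ - η * N - η) / sinh (θ - η * N))
      else if Fin.tail s = fun _ => 0 then
        sinh (l - ξ 0) * sinh (θ - η * N - η) / sinh (θ - η * N) *
          upEigenvalue η l κ (Fin.tail ξ) *
          (sinh η * sinh (θ - η * N + (l + ξ 0)) / sinh (θ - η * N)) +
        sinh η * sinh (θ - η * N - (l - ξ 0)) / sinh (θ - η * N) *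
          downEigenvalue η θ l κ N (Fin.tail ξ) *
          (sinh (l + ξ 0) * sinh (θ - η * N - η) / sinh (θ - η * N))
      else 0 := by
  simp only [rowOp, Matrix.of_apply, Fin.sum_univ_two, tail_const, dynR_entries,
    rowOp_one_one_up, rowOp_one_zero_up, rowOp_zero_zero_up, magnetization_const_zero]
  generalize s 0 = x
  fin_cases x
  · simp [dynR_entries, dynR_up_up_up_up, dynR_up_down_up_down]
  · by_cases h : Fin.tail s = fun _ => 0
    · simp [dynR_entries, dynR_up_down_down_up, dynR_up_down_up_down, dynR_down_up_up_down, h,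
        magnetization_const_zero]
    · simp [dynR_entries, h]

/-- The diagonal boundary weights, with their denominators cleared. -/
noncomputable def boundaryWeight (δ ζ l : ℂ) : Fin 2 → ℂ :=
  ![sinh (δ - l) * sinh (ζ + l), sinh (ζ - l) * sinh (δ + l)]

theorem RegularHeights.sinh_sub_ne {η θ : ℂ} {N : ℕ} (h : RegularHeights η θ (N + 1)) {k : ℕ}
    (hk : k ≤ N) : sinh (θ - η * k) ≠ 0 := by
  convert h (-k) (by rw [abs_lt]; push_cast; omega) using 2
  push_cast; ring

/-- This is the dynamical analogue of replacing `D` by a combination of `A` and `D` with a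
factorised eigenvalue. The second term on the right contains the eigenvalue of `A` at the crossed
parameter `-l - η`. -/
theorem downEigenvalue_eq {η δ ζ : ℂ} (l : ℂ) {N : ℕ} (ξ : Fin N → ℂ)
    (hθ : RegularHeights η (δ - ζ) N) :
    downEigenvalue η (δ - ζ) l (boundaryWeight δ ζ l) N ξ * sinh (2 * l + η) *
        sinh (δ - ζ - η * N + η) =
      sinh η * sinh (δ - ζ - η * N + η + 2 * l) * upEigenvalue η l (boundaryWeight δ ζ l) ξ +
        sinh (δ - ζ - η * N) * sinh (2 * l) * (sinh (δ + l + η) * sinh (ζ - l - η)) *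
          ∏ i, sinh (l - ξ i) * sinh (l + ξ i) := by
  induction N with
  | zero =>
    -- On the empty lattice this is a relation between the boundary weights that relies on the
    -- height being `δ - ζ`.
    simp only [downEigenvalue, upEigenvalue, boundaryWeight, univ_eq_empty, prod_empty]
    simp only [Matrix.cons_val_zero, Matrix.cons_val_one, CharP.cast_eq_zero, mul_zero, sub_zero,
      two_mul, sinh_eq_exp_div, exp_add, exp_sub]
    field_simp
    ring
  | succ N ih =>
    have ih := ih (Fin.tail ξ) (hθ.mono (by omega))
    have h0 : sinh (δ - ζ - η * N) ≠ 0 := hθ.sinh_sub_ne le_rfl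
    have e₁ : δ - ζ - η * ((N + 1 : ℕ) : ℂ) + η = δ - ζ - η * N := by push_cast; ring
    have e₂ : δ - ζ - η * ((N + 1 : ℕ) : ℂ) = δ - ζ - η * N - η := by push_cast; ring
    rw [downEigenvalue, upEigenvalue_succ, Fin.prod_univ_succ, e₁, e₂]
    set h := δ - ζ - η * N
    have key : sinh (l - ξ 0 + η) * sinh (l + ξ 0 + η) * sinh h * sinh (h + 2 * l) =
        sinh (l - ξ 0) * sinh (l + ξ 0) * sinh (h - η) * sinh (h + η + 2 * l) +
          sinh η * sinh (2 * l + η) * sinh (h + (l - ξ 0)) * sinh (h + (l + ξ 0)) := by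
      simp only [two_mul, sinh_eq_exp_div, exp_add, exp_sub]
      field_simp
      ring
    set α := upEigenvalue η l (boundaryWeight δ ζ l) (Fin.tail ξ)
    set β := downEigenvalue η (δ - ζ) l (boundaryWeight δ ζ l) N (Fin.tail ξ)
    set g := sinh (δ + l + η) * sinh (ζ - l - η)
    change _ = _ + _ * (_ * ∏ i, sinh (l - Fin.tail ξ i) * sinh (l + Fin.tail ξ i))
    set B := ∏ i, sinh (l - Fin.tail ξ i) * sinh (l + Fin.tail ξ i)
    generalize sinh (2 * l + η) = p₁, sinh (2 * l) = p₂, sinh (h + 2 * l) = p₃,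
      sinh (h + η + 2 * l) = p₄, sinh (h + (l - ξ 0)) = p₅, sinh (h + (l + ξ 0)) = p₆ at ih key ⊢
    field_simp
    linear_combination (sinh (l - ξ 0) * sinh (l + ξ 0) * sinh (h - η)) * ih - sinh η * α * key

/-- The coefficient of the state with a single down spin, on the leftmost site, produced from the
reference state. -/
theorem single_down_coefficient {η δ ζ : ℂ} (l : ℂ) {N : ℕ} (ξ : Fin (N + 1) → ℂ)
    (hθ : RegularHeights η (δ - ζ) (N + 1)) (s : Config (N + 1)) (h0 : s 0 = 1)
    (hs : Fin.tail s = fun _ => 0) :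
    rowOp η (δ - ζ) l (boundaryWeight δ ζ l) (N + 1) ξ 0 1 s (fun _ => 0) * sinh (2 * l + η) *
        (sinh (δ - ζ - η * N + η) * sinh (δ - ζ - η * N)) =
      sinh (2 * l) * (sinh η * sinh (δ - ζ - η * N - η)) *
        (sinh (δ - ζ - η * N + ξ 0 + l + η) * sinh (l + η - ξ 0) *
            (sinh (δ - l) * sinh (ζ + l)) *
            ∏ i, sinh (l - Fin.tail ξ i + η) * sinh (l + Fin.tail ξ i + η) +
          sinh (δ - ζ - η * N + ξ 0 - l) * sinh (l + ξ 0) *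
            (sinh (δ + l + η) * sinh (ζ - l - η)) *
            ∏ i, sinh (l - Fin.tail ξ i) * sinh (l + Fin.tail ξ i)) := by
  have hd := downEigenvalue_eq l (Fin.tail ξ) (hθ.mono N.le_succ)
  have hne : sinh (δ - ζ - η * N) ≠ 0 := hθ.sinh_sub_ne le_rfl
  rw [rowOp_zero_one_up, if_neg (by rw [h0]; simp), if_pos hs]
  set h := δ - ζ - η * N
  -- The total coefficient of the `A` eigenvalue, its direct term plus its share from `hd`,
  -- factorises and releases the factor `sinh (2 * l)`.
  have key : sinh (l - ξ 0) * sinh (h + (l + ξ 0)) * sinh (2 * l + η) * sinh (h + η) +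
      sinh (h - (l - ξ 0)) * sinh (l + ξ 0) * sinh η * sinh (h + η + 2 * l) =
      sinh h * sinh (2 * l) * (sinh (h + ξ 0 + l + η) * sinh (l + η - ξ 0)) := by
    simp only [two_mul, sinh_eq_exp_div, exp_add, exp_sub]
    field_simp
    ring
  have e : h + ξ 0 - l = h - (l - ξ 0) := by ring
  have hα : upEigenvalue η l (boundaryWeight δ ζ l) (Fin.tail ξ) = sinh (δ - l) * sinh (ζ + l) *
      ∏ i, sinh (l - Fin.tail ξ i + η) * sinh (l + Fin.tail ξ i + η) := rfl
  rw [hα] at hd ⊢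
  rw [e]
  generalize ∏ i, sinh (l - Fin.tail ξ i + η) * sinh (l + Fin.tail ξ i + η) = A,
    ∏ i, sinh (l - Fin.tail ξ i) * sinh (l + Fin.tail ξ i) = B,
    downEigenvalue η (δ - ζ) l (boundaryWeight δ ζ l) N (Fin.tail ξ) = β,
    sinh (δ - l) * sinh (ζ + l) = k, sinh (δ + l + η) * sinh (ζ - l - η) = g at hd ⊢
  generalize sinh (2 * l + η) = p₁, sinh (2 * l) = p₂, sinh (h + ξ 0 + l + η) = p₃,
    sinh (h + η + 2 * l) = p₄, sinh (h - (l - ξ 0)) = p₅, sinh (h + (l + ξ 0)) = p₆,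
    sinh (l + η - ξ 0) = p₇ at hd key ⊢
  field_simp
  linear_combination (sinh η * sinh (h - η) * k * A) * key +
    (sinh η * sinh (h - η) * p₅ * sinh (l + ξ 0)) * hd

/-! ### Polynomiality in the last spectral parameter. -/

open Polynomial Filter Topology

theorem cosh_add_sub_cosh_sub (a b : ℂ) : cosh (a + b) - cosh (a - b) = 2 * (sinh a * sinh b) := by
  rw [cosh_add, cosh_sub]; ring

/-- Expand each `cosh (w + ψ i)` and replace `sinh w ^ 2` by `cosh w ^ 2 - 1`. The top coefficients
then multiply by the addition formulas for `cosh` and `sinh`. -/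
theorem exists_polynomial_prod_cosh (m : ℕ) (ψ k : Fin (m + 1) → ℂ) :
    ∃ P Q : ℂ[X], P.natDegree ≤ m + 1 ∧ Q.natDegree ≤ m ∧ P.coeff (m + 1) = cosh (∑ i, ψ i) ∧
      Q.coeff m = sinh (∑ i, ψ i) ∧ ∀ w, ∏ i, (cosh (w + ψ i) - k i) =
        P.eval (cosh w) + sinh w * Q.eval (cosh w) := by
  induction m with
  | zero =>
    refine ⟨C (cosh (ψ 0)) * X - C (k 0), C (sinh (ψ 0)), ?_, ?_, ?_, ?_, ?_⟩
    · compute_degree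
    · simp
    · simp [coeff_C]
    · simp
    · intro w
      simp [cosh_add]
      ring
  | succ m ih =>
    obtain ⟨P, Q, hP, hQ, hPc, hQc, h⟩ := ih (fun i => ψ i.succ) (fun i => k i.succ)
    have hL : (C (cosh (ψ 0)) * X - C (k 0)).natDegree ≤ 1 := by compute_degree
    have hL1 : (C (cosh (ψ 0)) * X - C (k 0)).coeff 1 = cosh (ψ 0) := by simp [coeff_C]
    have hX : (X ^ 2 - 1 : ℂ[X]).natDegree ≤ 2 := by compute_degree
    have hX2 : (X ^ 2 - 1 : ℂ[X]).coeff 2 = 1 := by simp [coeff_one]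
    have d₁ := natDegree_mul_le_of_le hL hP
    have d₂ := natDegree_mul_le_of_le hX hQ
    have d₃ := natDegree_mul_le_of_le hL hQ
    refine ⟨(C (cosh (ψ 0)) * X - C (k 0)) * P + C (sinh (ψ 0)) * ((X ^ 2 - 1) * Q),
      (C (cosh (ψ 0)) * X - C (k 0)) * Q + C (sinh (ψ 0)) * P, ?_, ?_, ?_, ?_, ?_⟩
    · refine (natDegree_add_le_of_degree_le (d₁.trans (by omega))
        ((natDegree_C_mul_le _ _).trans (d₂.trans (by omega))))
    · exact natDegree_add_le_of_degree_le (d₃.trans (by omega))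
        ((natDegree_C_mul_le _ _).trans (hP.trans (by omega)))
    · have e₁ := coeff_mul_add_eq_of_natDegree_le hL hP
      have e₂ := coeff_mul_add_eq_of_natDegree_le hX hQ
      rw [show 1 + (m + 1) = m + 1 + 1 by ring, hL1, hPc] at e₁
      rw [show 2 + m = m + 1 + 1 by ring, hX2, hQc] at e₂
      rw [coeff_add, coeff_C_mul, e₁, e₂, Fin.sum_univ_succ ψ, cosh_add]
      ring
    · have e₁ := coeff_mul_add_eq_of_natDegree_le hL hQ
      rw [show 1 + m = m + 1 by ring, hL1, hQc] at e₁
      rw [coeff_add, coeff_C_mul, e₁, hPc, Fin.sum_univ_succ ψ, sinh_add]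
      ring
    · intro w
      rw [Fin.prod_univ_succ, h w, cosh_add]
      have := cosh_sq w
      simp
      linear_combination (-sinh (ψ 0) * Q.eval (cosh w)) * this

/-- Antisymmetrising in `w` keeps only the part odd in `w`. Its top coefficient is `sinh (∑ i, ψ i)
= 0`, so one degree is gained. -/
theorem exists_polynomial_prod_cosh_sub (n : ℕ) (ψ k : Fin (n + 2) → ℂ) (hψ : ∑ i, ψ i = 0) :
    ∃ Q : ℂ[X], Q.natDegree ≤ n ∧ ∀ w, ∏ i, (cosh (w + ψ i) - k i) -
      ∏ i, (cosh (-w + ψ i) - k i) = sinh w * Q.eval (cosh w) := by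
  obtain ⟨P, Q, -, hQ, -, hQc, h⟩ := exists_polynomial_prod_cosh (n + 1) ψ k
  refine ⟨C 2 * Q, (natDegree_C_mul_le _ _).trans ?_, fun w => ?_⟩
  · rw [hψ, sinh_zero] at hQc
    exact natDegree_le_pred hQ hQc
  · rw [h, h, cosh_neg, sinh_neg]
    simp
    ring

/-- The zeros of `sinh` are simple, because `cosh ^ 2 = sinh ^ 2 + 1`, and hence isolated. -/
theorem eventually_sinh_ne_zero {a : ℂ} (ha : a ≠ 0) (b z : ℂ) :
    ∀ᶠ t in 𝓝[≠] z, sinh (a * t + b) ≠ 0 := by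
  by_cases h : sinh (a * z + b) = 0
  · have hd : HasDerivAt (fun t => sinh (a * t + b)) (cosh (a * z + b) * a) z := by
      have : HasDerivAt (fun t => a * t + b) a z := by
        simpa using ((hasDerivAt_id z).const_mul a).add_const b
      exact this.csinh
    apply hd.eventually_ne
    refine mul_ne_zero (fun hc => ?_) ha
    have := cosh_sq (a * z + b)
    rw [h, hc] at this
    norm_num at this
  · have hc : ContinuousAt (fun t => sinh (a * t + b)) z := by fun_prop
    exact (hc.eventually_ne h).filter_mono nhdsWithin_le_nhds

theorem eq_of_eventually_eq_punctured {f g : ℂ → ℂ} {z : ℂ} (hf : ContinuousAt f z)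
    (hg : ContinuousAt g z) (h : ∀ᶠ t in 𝓝[≠] z, f t = g t) : f z = g z :=
  tendsto_nhds_unique_of_eventuallyEq (hf.tendsto.mono_left nhdsWithin_le_nhds)
    (hg.tendsto.mono_left nhdsWithin_le_nhds) h

theorem continuous_dynR {X : Type*} [TopologicalSpace X] (η θ : ℂ) {l : X → ℂ} (hl : Continuous l)
    (p q : Fin 2 × Fin 2) : Continuous fun x => dynR η (l x) θ p q := by
  obtain ⟨a, b⟩ := p
  obtain ⟨c, d⟩ := q
  fin_cases a <;> fin_cases b <;> fin_cases c <;> fin_cases d <;>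
    simp [dynR_entries, dynR_up_up_up_up, dynR_down_down_down_down, dynR_up_down_up_down,
      dynR_up_down_down_up, dynR_down_up_up_down, dynR_down_up_down_up, div_eq_mul_inv] <;> fun_prop

theorem continuous_rowOp {X : Type*} [TopologicalSpace X] (η θ : ℂ) {l : X → ℂ}
    {κ : X → Fin 2 → ℂ} (hl : Continuous l) (hκ : Continuous κ) {N : ℕ} {ξ : X → Fin N → ℂ}
    (hξ : Continuous ξ) (a b : Fin 2) (s t : Config N) :
    Continuous fun x => rowOp η θ (l x) (κ x) N (ξ x) a b s t := by
  induction N generalizing a b with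
  | zero =>
    simp only [rowOp, Matrix.of_apply]
    split_ifs
    · fun_prop
    · fun_prop
  | succ N ih =>
    simp only [rowOp, Matrix.of_apply]
    have h0 : Continuous fun x => ξ x 0 := by fun_prop
    have ht : Continuous fun x => Fin.tail (ξ x) := by unfold Fin.tail; fun_prop
    refine continuous_finsetSum _ fun c _ => continuous_finsetSum _ fun d _ =>
      continuous_finsetSum _ fun y _ => ?_
    exact ((continuous_dynR η _ (hl.sub h0) _ _).mul (ih ht c d _ _)).mul
      (continuous_dynR η _ (hl.add h0) _ _)

theorem continuous_boundaryWeight (δ ζ : ℂ) : Continuous (boundaryWeight δ ζ) := by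
  refine continuous_pi fun c => ?_
  fin_cases c <;> simp [boundaryWeight] <;> fun_prop

/-- The two terms produced by a single down spin are exchanged by the crossing `l ↦ -l - η`. -/
theorem exists_polynomial_crossing (η δ ζ x h : ℂ) {N : ℕ} (ξ : Fin N → ℂ)
    (hh : h = δ - ζ - η * N) : ∃ Q : ℂ[X], Q.natDegree ≤ N ∧ ∀ l,
      sinh (h + x + l + η) * sinh (l + η - x) * (sinh (δ - l) * sinh (ζ + l)) *
            ∏ i, sinh (l - ξ i + η) * sinh (l + ξ i + η) +
          sinh (h + x - l) * sinh (l + x) * (sinh (δ + l + η) * sinh (ζ - l - η)) *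
            ∏ i, sinh (l - ξ i) * sinh (l + ξ i) =
        sinh (2 * l + η) * Q.eval (cosh (2 * l + η)) := by
  -- With `w = 2 * l + η`, crossing is `w ↦ -w`. The shifts `h + η`, `-(δ - ζ + η)` and `N` copies
  -- of `η` add up to zero exactly because `h = δ - ζ - η * N`.
  obtain ⟨Q, hQ, hQe⟩ := exists_polynomial_prod_cosh_sub N
    (Fin.cons (h + η) (Fin.cons (-(δ - ζ + η)) fun _ => η))
    (Fin.cons (cosh (h + 2 * x)) (Fin.cons (cosh (δ + ζ)) fun i => cosh (2 * ξ i)))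
    (by simp [Fin.sum_univ_succ, hh]; ring)
  -- Each of the `N + 2` differences of `cosh` carries a factor 2. The signs in `f₂`, `f₄` and `f₅`
  -- turn the difference of products into minus the required sum.
  refine ⟨C (-((1 / 2) ^ (N + 2))) * Q, (natDegree_C_mul_le _ _).trans hQ, fun l => ?_⟩
  have hl := hQe (2 * l + η)
  simp only [Fin.prod_univ_succ, Fin.cons_zero, Fin.cons_succ] at hl
  have f₁ : cosh (2 * l + η + (h + η)) - cosh (h + 2 * x) =
      2 * (sinh (h + x + l + η) * sinh (l + η - x)) := by
    rw [← cosh_add_sub_cosh_sub]; ring_nf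
  have f₂ : cosh (2 * l + η + -(δ - ζ + η)) - cosh (δ + ζ) =
      -(2 * (sinh (δ - l) * sinh (ζ + l))) := by
    rw [← cosh_add_sub_cosh_sub, ← cosh_neg (2 * l + η + -(δ - ζ + η))]; ring_nf
  have f₃ : ∀ i, cosh (2 * l + η + η) - cosh (2 * ξ i) =
      2 * (sinh (l - ξ i + η) * sinh (l + ξ i + η)) := by
    intro i
    rw [← cosh_add_sub_cosh_sub, ← cosh_neg (2 * ξ i)]; ring_nf
  have f₄ : cosh (-(2 * l + η) + (h + η)) - cosh (h + 2 * x) =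
      -(2 * (sinh (h + x - l) * sinh (l + x))) := by
    rw [← cosh_add_sub_cosh_sub]; ring_nf
  have f₅ : cosh (-(2 * l + η) + -(δ - ζ + η)) - cosh (δ + ζ) =
      -(2 * (sinh (δ + l + η) * sinh (ζ - l - η))) := by
    rw [← cosh_add_sub_cosh_sub, ← cosh_neg (-(2 * l + η) + -(δ - ζ + η))]; ring_nf
  have f₆ : ∀ i, cosh (-(2 * l + η) + η) - cosh (2 * ξ i) =
      2 * (sinh (l - ξ i) * sinh (l + ξ i)) := by
    intro i
    rw [← cosh_add_sub_cosh_sub, ← cosh_neg (2 * ξ i), ← cosh_neg (-(2 * l + η) + η)]; ring_nf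
  simp only [f₁, f₂, f₃, f₄, f₅, f₆, prod_mul_distrib, prod_const, card_univ,
    Fintype.card_fin] at hl
  simp only [prod_mul_distrib, eval_mul, eval_C]
  have h2 : (1 / 2 : ℂ) ^ (N + 2) * 2 ^ N = 1 / 4 := by
    rw [pow_add, one_div, inv_pow]; field_simp; norm_num
  linear_combination (-(1 / 2 : ℂ) ^ (N + 2)) * hl - 4 * (
    sinh (h + x + l + η) * sinh (l + η - x) * (sinh (δ - l) * sinh (ζ + l)) *
            ((∏ i, sinh (l - ξ i + η)) * ∏ i, sinh (l + ξ i + η)) +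
          sinh (h + x - l) * sinh (l + x) * (sinh (δ + l + η) * sinh (ζ - l - η)) *
            ((∏ i, sinh (l - ξ i)) * ∏ i, sinh (l + ξ i))) * h2

theorem exists_polynomial_rowOp {η δ ζ : ℂ} {N : ℕ} (hθ : RegularHeights η (δ - ζ) (N + 1))
    (ξ : Fin (N + 1) → ℂ) (s : Config (N + 1)) : ∃ Q : ℂ[X], Q.natDegree ≤ N ∧ ∀ l,
      rowOp η (δ - ζ) l (boundaryWeight δ ζ l) (N + 1) ξ 0 1 s (fun _ => 0) =
        sinh (2 * l) * Q.eval (cosh (2 * l + η)) := by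
  induction N with
  | zero =>
    -- One site is treated directly: `single_down_coefficient` carries the factor `sinh (δ - ζ +
    -- η)`, whose nonvanishing is not available here.
    have hne : sinh (δ - ζ - η * (0 : ℕ)) ≠ 0 := hθ.sinh_sub_ne le_rfl
    simp only [rowOp_zero_one_up]
    split_ifs with h0 hs
    · exact ⟨0, by simp, by simp [rowOp]⟩
    · refine ⟨C (sinh η * sinh (δ - ζ - η) / sinh (δ - ζ) * (sinh (δ + ξ 0) * sinh (ζ - ξ 0))),
        (natDegree_C _).le, fun l => ?_⟩
      simp only [CharP.cast_eq_zero, mul_zero, sub_zero, upEigenvalue, downEigenvalue,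
        boundaryWeight, eval_C, univ_eq_empty, prod_empty] at hne ⊢
      simp only [Matrix.cons_val_zero, Matrix.cons_val_one]
      have key : sinh (l - ξ 0) * sinh (δ - ζ + (l + ξ 0)) * (sinh (δ - l) * sinh (ζ + l)) +
          sinh (δ - ζ - (l - ξ 0)) * sinh (l + ξ 0) * (sinh (ζ - l) * sinh (δ + l)) =
          sinh (δ - ζ) * sinh (2 * l) * (sinh (δ + ξ 0) * sinh (ζ - ξ 0)) := by
        simp only [two_mul, sinh_eq_exp_div, exp_add, exp_sub]
        field_simp
        ring
      generalize sinh (δ - ζ + (l + ξ 0)) = p₁, sinh (δ - ζ - (l - ξ 0)) = p₂,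
        sinh (2 * l) = p₃, sinh (δ - ζ) = p₄ at key hne ⊢
      field_simp
      linear_combination (sinh η * sinh (δ - ζ - η)) * key
    · exact ⟨0, by simp, by simp⟩
  | succ N ih =>
    by_cases h0 : s 0 = 0
    · obtain ⟨Q, hQ, hQe⟩ := ih (hθ.mono (by omega)) (Fin.tail ξ) (Fin.tail s)
      set h := δ - ζ - η * ((N + 1 : ℕ) : ℂ)
      refine ⟨C (sinh (h - η) / sinh h / 2) * (X - C (cosh (2 * ξ 0 - η))) * Q, ?_, fun l => ?_⟩
      · refine (natDegree_mul_le_of_le (m := 1) ?_ hQ).trans (by omega)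
        refine (natDegree_C_mul_le _ _).trans ?_
        compute_degree
      · rw [rowOp_zero_one_up, if_pos h0, hQe]
        have sub : cosh (2 * l + η) - cosh (2 * ξ 0 - η) =
            2 * (sinh (l + ξ 0) * sinh (l - ξ 0 + η)) := by
          have e₁ : 2 * l + η = (l + ξ 0) + (l - ξ 0 + η) := by ring
          have e₂ : 2 * ξ 0 - η = (l + ξ 0) - (l - ξ 0 + η) := by ring
          rw [e₁, e₂, cosh_add, cosh_sub]; ring
        simp only [eval_mul, eval_sub, eval_X, eval_C, sub]
        ring
    · by_cases hs : Fin.tail s = fun _ => 0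
      · have h1 : s 0 = 1 := by omega
        have hne : sinh (δ - ζ - η * ((N + 1 : ℕ) : ℂ)) ≠ 0 := hθ.sinh_sub_ne le_rfl
        have hne' : sinh (δ - ζ - η * ((N + 1 : ℕ) : ℂ) + η) ≠ 0 := by
          convert hθ.sinh_sub_ne (k := N) (by omega) using 2
          push_cast; ring
        obtain ⟨Q, hQ, hQe⟩ := exists_polynomial_crossing η δ ζ (ξ 0) _ (Fin.tail ξ) rfl
        have hc := fun l => single_down_coefficient l ξ hθ s h1 hs
        set h := δ - ζ - η * ((N + 1 : ℕ) : ℂ)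
        refine ⟨C (sinh η * sinh (h - η) / (sinh (h + η) * sinh h)) * Q,
          (natDegree_C_mul_le _ _).trans hQ, fun z => ?_⟩
        -- The factor `sinh (2 * l + η)` can be cancelled only away from its zeros; continuity of
        -- both sides covers the value at `z`.
        refine eq_of_eventually_eq_punctured
          (f := fun l => rowOp η (δ - ζ) l (boundaryWeight δ ζ l) (N + 1 + 1) ξ 0 1 s fun _ => 0)
          (g := fun l => sinh (2 * l) * (C (sinh η * sinh (h - η) / (sinh (h + η) * sinh h)) *
            Q).eval (cosh (2 * l + η)))
          (continuous_rowOp η _ continuous_id (continuous_boundaryWeight δ ζ)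
            continuous_const 0 1 s _).continuousAt ?_ ?_
        · have := Polynomial.continuous
            (C (sinh η * sinh (h - η) / (sinh (h + η) * sinh h)) * Q)
          fun_prop
        · filter_upwards [eventually_sinh_ne_zero two_ne_zero η z] with l hl
          have hcl := hc l
          rw [hQe l] at hcl
          rw [eval_mul, eval_C]
          have hcl' : rowOp η (δ - ζ) l (boundaryWeight δ ζ l) (N + 1 + 1) ξ 0 1 s (fun _ => 0) *
              (sinh (h + η) * sinh h) = sinh (2 * l) * (sinh η * sinh (h - η)) *
                Q.eval (cosh (2 * l + η)) := by
            apply mul_left_cancel₀ hl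
            linear_combination hcl
          rw [← mul_right_inj' (mul_ne_zero hne' hne), mul_comm, hcl']
          generalize eval (cosh (2 * l + η)) Q = q
          generalize sinh (2 * l) = p
          field_simp
      · exact ⟨0, by simp, fun l => by
          rw [rowOp_zero_one_up, if_neg h0, if_neg hs]; simp⟩

/-! ### Products of `B` operators and frozen columns. -/

theorem partitionFn_succ (η θ : ℂ) (κ : ℂ → Fin 2 → ℂ) {M N : ℕ} (l : Fin (M + 1) → ℂ)
    (ξ : Fin N → ℂ) : partitionFn η θ κ l ξ =
      rowOp η θ (l 0) (κ (l 0)) N ξ 0 1 * partitionFn η θ κ (Fin.tail l) ξ := by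
  simp only [partitionFn, List.ofFn_succ, List.prod_cons]
  rfl

theorem partitionFn_snoc (η θ : ℂ) (κ : ℂ → Fin 2 → ℂ) {M N : ℕ} (l : Fin M → ℂ) (z : ℂ)
    (ξ : Fin N → ℂ) : partitionFn η θ κ (Fin.snoc l z : Fin (M + 1) → ℂ) ξ =
      partitionFn η θ κ l ξ * rowOp η θ z (κ z) N ξ 0 1 := by
  simp only [partitionFn, List.ofFn_succ', Fin.snoc_castSucc, Fin.snoc_last,
    List.prod_append, List.prod_singleton, List.concat_eq_append]

theorem partitionFn_eq_zero (η θ : ℂ) (κ : ℂ → Fin 2 → ℂ) {M N : ℕ} (l : Fin M → ℂ)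
    (ξ : Fin N → ℂ) (s t : Config N) (h : magnetization s + 2 * M ≠ magnetization t) :
    partitionFn η θ κ l ξ s t = 0 := by
  induction M generalizing s with
  | zero =>
    have : s ≠ t := by rintro rfl; simp at h
    simp [partitionFn, this]
  | succ M ih =>
    rw [partitionFn_succ, Matrix.mul_apply]
    refine sum_eq_zero fun u _ => ?_
    by_cases hu : magnetization u + 2 * M = magnetization t
    · rw [rowOp_eq_zero, zero_mul]
      rw [sigmaZ_zero, sigmaZ_one]
      intro h'
      apply h
      push_cast
      linear_combination h' + hu
    · rw [ih _ _ hu, mul_zero]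

/-- The ice rule fixes both vertices of a leftmost column entered by a down spin: the spin stays
down and the column contributes only a scalar. -/
theorem rowOp_zero_one_down (η θ l : ℂ) (κ : Fin 2 → ℂ) {N : ℕ} (ξ : Fin (N + 1) → ℂ)
    (s t : Config (N + 1)) (ht : t 0 = 1) :
    rowOp η θ l κ (N + 1) ξ 0 1 s t = if s 0 = 1 then
      sinh (l + ξ 0 + η) * sinh (l - ξ 0) * (sinh (θ - η * magnetization (Fin.tail s) - η) /
        sinh (θ - η * magnetization (Fin.tail s))) *
        rowOp η θ l κ N (Fin.tail ξ) 0 1 (Fin.tail s) (Fin.tail t) else 0 := by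
  simp only [rowOp, Matrix.of_apply, Fin.sum_univ_two, dynR_entries, ht]
  generalize s 0 = x
  fin_cases x
  · simp [dynR_entries]
  · simp [dynR_entries, dynR_down_down_down_down, dynR_up_down_up_down]
    ring

theorem partitionFn_up_column (η θ : ℂ) (κ : ℂ → Fin 2 → ℂ) {M N : ℕ} (l : Fin M → ℂ)
    (ξ : Fin (N + 1) → ℂ) (s t : Config (N + 1)) (ht : t 0 = 1) (hs : s 0 = 0) :
    partitionFn η θ κ l ξ s t = 0 := by
  induction M generalizing s with
  | zero =>
    have : s ≠ t := by rintro rfl; simp [hs] at ht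
    simp [partitionFn, this]
  | succ M ih =>
    rw [partitionFn_succ, Matrix.mul_apply, sum_config_succ, Fin.sum_univ_two]
    have h0 : ∀ v : Config N, partitionFn η θ κ (Fin.tail l) ξ (Fin.cons 0 v) t = 0 :=
      fun v => ih _ _ rfl
    have h1 : ∀ v : Config N, rowOp η θ (l 0) (κ (l 0)) (N + 1) ξ 0 1 s (Fin.cons 1 v) = 0 :=
      fun v => by rw [rowOp_zero_one_down _ _ _ _ _ _ _ rfl, if_neg (by simp [hs])]
    simp [h0, h1]

/-- The columns to the right of a frozen column of down spins. -/
theorem partitionFn_down_column (η θ : ℂ) (κ : ℂ → Fin 2 → ℂ) {M N : ℕ} (l : Fin M → ℂ)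
    (ξ : Fin (N + 1) → ℂ) (s t : Config (N + 1)) (ht : t 0 = 1) (hs : s 0 = 1)
    (htt : Fin.tail t = fun _ => 0) :
    partitionFn η θ κ l ξ s t = (∏ i, sinh (l i + ξ 0 + η) * sinh (l i - ξ 0)) *
      (∏ k ∈ range M, sinh (θ - η * (N - 2 * (k + 1 : ℕ)) - η) /
        sinh (θ - η * (N - 2 * (k + 1 : ℕ)))) *
      partitionFn η θ κ l (Fin.tail ξ) (Fin.tail s) (fun _ => 0) := by
  induction M generalizing s with
  | zero =>
    simp [partitionFn, Matrix.one_apply, config_eq_iff (s := s), ht, hs, htt]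
  | succ M ih =>
    rw [partitionFn_succ, Matrix.mul_apply, sum_config_succ, Fin.sum_univ_two]
    have h0 : ∀ v : Config N, partitionFn η θ κ (Fin.tail l) ξ (Fin.cons 0 v) t = 0 :=
      fun v => partitionFn_up_column η θ κ _ ξ _ t ht rfl
    simp only [h0, mul_zero, sum_const_zero, zero_add]
    rw [partitionFn_succ, Matrix.mul_apply, mul_sum]
    refine sum_congr rfl fun v _ => ?_
    rw [ih (Fin.tail l) (Fin.cons 1 v) rfl, rowOp_zero_one_down _ _ _ _ _ _ _ (by simp), if_pos hs,
      Fin.prod_univ_succ, prod_range_succ]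
    simp only [Fin.tail_cons]
    -- Each row lowers the magnetization by 2, so the height next to the frozen column depends only
    -- on the row; configurations violating this contribute zero.
    by_cases hv : magnetization v + 2 * M = N
    · by_cases hv' : magnetization (Fin.tail s) + 2 = magnetization v
      · have : magnetization (Fin.tail s) = N - 2 * (M + 1 : ℕ) := by
          push_cast; linear_combination hv' + hv
        rw [this]
        simp only [Fin.tail]
        ring
      · rw [rowOp_eq_zero _ _ _ _ _ _ _ (Fin.tail s) v]
        · ring
        · rw [sigmaZ_zero, sigmaZ_one]
          intro h; apply hv'; linear_combination h
    · rw [partitionFn_eq_zero _ _ _ _ _ v, mul_zero, mul_zero, mul_zero, mul_zero]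
      rwa [magnetization_const_zero]

/-! ### The determinant formula with cleared denominators and its recursion. -/

/-- The constant in the determinant formula, defined by the recursion that the freezing of a column
produces. -/
noncomputable def formulaConst (η θ : ℂ) : ℕ → ℂ
  | 0 => 1
  | N + 1 => (-1) ^ N * formulaConst η θ N *
      (∏ k ∈ range N, sinh (θ - η * (N - 2 * (k + 1 : ℕ)) - η) /
        sinh (θ - η * (N - 2 * (k + 1 : ℕ)))) *
      (sinh (θ - η * N - η) / sinh (θ - η * N))

/-- The product of the weights that couple the spectral parameter `l` to the column `x`. -/
noncomputable def crossWeight (η x l : ℂ) : ℂ :=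
  sinh (l + x) * sinh (l - x) * sinh (l + x + η) * sinh (l - x + η)

/-- The matrix of the determinant formula with its denominators cleared. -/
noncomputable def clearedMatrix (η : ℂ) {N : ℕ} (l ξ : Fin N → ℂ) : Matrix (Fin N) (Fin N) ℂ :=
  Matrix.of fun i j => ∏ k ∈ univ.erase j, crossWeight η (ξ k) (l i)

/-- The Vandermonde product in the variables `cosh (2 ξ j) / 2`. -/
noncomputable def columnVandermonde {N : ℕ} (ξ : Fin N → ℂ) : ℂ :=
  (Matrix.vandermonde fun j => cosh (2 * ξ j) / 2).det

/-- The Vandermonde product in the variables `cosh (2 l i + η) / 2`. -/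
noncomputable def rowVandermonde (η : ℂ) {N : ℕ} (l : Fin N → ℂ) : ℂ :=
  (Matrix.vandermonde fun i => cosh (2 * l i + η) / 2).det

noncomputable def boundaryFactor (η δ ζ x : ℂ) : ℂ := sinh (δ + x) * sinh (ζ - x) * sinh η

/-- The determinant formula with its denominators cleared. -/
def ClearedFormula (η δ ζ : ℂ) {N : ℕ} (l ξ : Fin N → ℂ) : Prop :=
  partitionFn η (δ - ζ) (boundaryWeight δ ζ) l ξ (fun _ => 1) (fun _ => 0) *
      (columnVandermonde ξ * rowVandermonde η l) =
    formulaConst η (δ - ζ) N * (∏ i, sinh (2 * l i)) * (∏ j, boundaryFactor η δ ζ (ξ j)) *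
      (clearedMatrix η l ξ).det

theorem prod_erase_eq_prod_ite {N : ℕ} (f : Fin N → ℂ) (j : Fin N) :
    ∏ k ∈ univ.erase j, f k = ∏ k, if k = j then 1 else f k := by
  rw [← filter_ne' univ j, prod_filter]
  exact prod_congr rfl fun k _ => by by_cases h : k = j <;> simp [h]

theorem columnVandermonde_succ {N : ℕ} (ξ : Fin (N + 1) → ℂ) :
    columnVandermonde ξ = (∏ j, sinh (Fin.tail ξ j + ξ 0) * sinh (Fin.tail ξ j - ξ 0)) *
      columnVandermonde (Fin.tail ξ) := by
  simp only [columnVandermonde, Matrix.det_vandermonde, Fin.prod_univ_succ, Fin.Ioi_zero_eq_map,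
    Fin.Ioi_succ, prod_map, Fin.tail]
  congr 1
  refine prod_congr rfl fun j _ => ?_
  have e₁ : 2 * ξ j.succ = (ξ j.succ + ξ 0) + (ξ j.succ - ξ 0) := by ring
  have e₂ : 2 * ξ 0 = (ξ j.succ + ξ 0) - (ξ j.succ - ξ 0) := by ring
  simp only [Fin.coe_succEmb]
  rw [← sub_div, e₁, e₂, cosh_add_sub_cosh_sub]
  ring

theorem rowVandermonde_snoc (η : ℂ) {N : ℕ} (l : Fin N → ℂ) (z : ℂ) :
    rowVandermonde η (Fin.snoc l z : Fin (N + 1) → ℂ) =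
      rowVandermonde η l * ∏ i, (cosh (2 * z + η) / 2 - cosh (2 * l i + η) / 2) := by
  simp only [rowVandermonde, Matrix.det_vandermonde, ← filter_lt_eq_Ioi, prod_filter,
    Fin.prod_univ_castSucc, Fin.snoc_castSucc, Fin.snoc_last, Fin.castSucc_lt_castSucc_iff,
    Fin.castSucc_lt_last, if_true, lt_self_iff_false, if_false, mul_one, prod_mul_distrib,
    (Fin.castSucc_lt_last _).not_gt, prod_const_one]

theorem cosh_sub_cosh_row (η z w : ℂ) : cosh (2 * z + η) / 2 - cosh (2 * w + η) / 2 =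
    sinh (z - w) * sinh (z + w + η) := by
  have e₁ : 2 * z + η = (z - w) + (z + w + η) := by ring
  have e₂ : 2 * w + η = (z + w + η) - (z - w) := by ring
  rw [← sub_div, e₁, e₂, ← cosh_neg (z + w + η - (z - w)), neg_sub, cosh_add_sub_cosh_sub]
  ring

theorem columnVandermonde_comp {N : ℕ} (ξ : Fin N → ℂ) (σ : Equiv.Perm (Fin N)) :
    columnVandermonde (ξ ∘ σ) = (Equiv.Perm.sign σ : ℤ) * columnVandermonde ξ := by
  rw [columnVandermonde, columnVandermonde, ← Matrix.det_permute]
  rfl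

theorem det_clearedMatrix_comp (η : ℂ) {N : ℕ} (l ξ : Fin N → ℂ) (σ : Equiv.Perm (Fin N)) :
    (clearedMatrix η l (ξ ∘ σ)).det = (Equiv.Perm.sign σ : ℤ) * (clearedMatrix η l ξ).det := by
  rw [← Matrix.det_permute']
  congr 1
  ext i j
  simp only [clearedMatrix, Matrix.of_apply, Matrix.submatrix_apply, id, Function.comp_apply]
  refine prod_bij (fun k _ => σ k) ?_ ?_ ?_ ?_
  · simp
  · simp
  · intro k hk
    exact ⟨σ.symm k, by simpa [Equiv.symm_apply_eq] using hk, by simp⟩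
  · simp

/-- The column Vandermonde product and the determinant both pick up the sign of `σ`; everything else
is symmetric in `ξ`. -/
theorem ClearedFormula.of_perm {η δ ζ : ℂ} {N : ℕ} (hθ : RegularHeights η (δ - ζ) N)
    {l ξ : Fin N → ℂ} (hξ : ∀ i j, i ≠ j → sinh (ξ i - ξ j + η) ≠ 0) (σ : Equiv.Perm (Fin N))
    (h : ClearedFormula η δ ζ l (ξ ∘ σ)) : ClearedFormula η δ ζ l ξ := by
  rw [ClearedFormula, partitionFn_perm hθ _ _ _ hξ, columnVandermonde_comp,
    det_clearedMatrix_comp] at h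
  have hprod : ∏ j, boundaryFactor η δ ζ ((ξ ∘ σ) j) = ∏ j, boundaryFactor η δ ζ (ξ j) :=
    Equiv.prod_comp σ fun j => boundaryFactor η δ ζ (ξ j)
  rw [hprod] at h
  have hs : ((Equiv.Perm.sign σ : ℤ) : ℂ) ≠ 0 := by
    exact_mod_cast (Equiv.Perm.sign σ).ne_zero
  rw [ClearedFormula]
  apply mul_left_cancel₀ hs
  linear_combination h

/-- At `-ξ 0` the weight `sinh (l + ξ 0)` vanishes. This removes every state with leftmost spin up
as well as the `D` term, so the last operator creates only the down spin on the leftmost site. -/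
theorem partitionFn_freeze {η δ ζ : ℂ} {N : ℕ} (hθ : RegularHeights η (δ - ζ) (N + 1))
    (l : Fin N → ℂ) (ξ : Fin (N + 1) → ℂ) :
    partitionFn η (δ - ζ) (boundaryWeight δ ζ) (Fin.snoc l (-ξ 0) : Fin (N + 1) → ℂ) ξ
        (fun _ => 1) (fun _ => 0) =
      (∏ i, sinh (l i + ξ 0 + η) * sinh (l i - ξ 0)) *
        (∏ k ∈ range N, sinh (δ - ζ - η * (N - 2 * (k + 1 : ℕ)) - η) /
          sinh (δ - ζ - η * (N - 2 * (k + 1 : ℕ)))) *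
        partitionFn η (δ - ζ) (boundaryWeight δ ζ) l (Fin.tail ξ) (fun _ => 1) (fun _ => 0) *
        (sinh (2 * -ξ 0) * (sinh (δ - ζ - η * N - η) / sinh (δ - ζ - η * N)) *
          boundaryFactor η δ ζ (ξ 0) *
          ∏ j, sinh (-ξ 0 - Fin.tail ξ j + η) * sinh (-ξ 0 + Fin.tail ξ j + η)) := by
  rw [partitionFn_snoc, Matrix.mul_apply, sum_eq_single (Fin.cons 1 fun _ => 0)]
  · have hne : sinh (δ - ζ - η * N) ≠ 0 := hθ.sinh_sub_ne le_rfl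
    rw [partitionFn_down_column _ _ _ _ _ _ _ rfl rfl (Fin.tail_cons _ _), rowOp_zero_one_up,
      if_neg (by simp), if_pos (Fin.tail_cons _ _), tail_const]
    simp only [upEigenvalue, boundaryWeight, boundaryFactor, Matrix.cons_val_zero,
      neg_add_cancel, sinh_zero, add_zero, sub_neg_eq_add, ← sub_eq_add_neg, zero_mul, mul_zero, zero_div]
    have e : -ξ 0 - ξ 0 = 2 * -ξ 0 := by ring
    rw [e]
    generalize sinh (2 * -ξ 0) = p
    field_simp
  · intro s _ hs
    rw [rowOp_zero_one_up]
    split_ifs with h0 h1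
    · simp
    · exact absurd (config_eq_iff.2 ⟨by rw [Fin.cons_zero]; omega, h1⟩) hs
    · rw [mul_zero]
  · simp

theorem ClearedFormula.snoc_freeze {η δ ζ : ℂ} {N : ℕ} (hθ : RegularHeights η (δ - ζ) (N + 1))
    {l : Fin N → ℂ} {ξ : Fin (N + 1) → ℂ} (h : ClearedFormula η δ ζ l (Fin.tail ξ)) :
    ClearedFormula η δ ζ (Fin.snoc l (-ξ 0) : Fin (N + 1) → ℂ) ξ := by
  have hdet : (clearedMatrix η (Fin.snoc l (-ξ 0) : Fin (N + 1) → ℂ) ξ).det =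
      (-1) ^ N * (∏ j, crossWeight η (Fin.tail ξ j) (-ξ 0)) *
        ((∏ i, crossWeight η (ξ 0) (l i)) * (clearedMatrix η l (Fin.tail ξ)).det) := by
    -- In the last row every entry outside column 0 contains `crossWeight η (ξ 0) (-ξ 0) = 0`, so
    -- the expansion has a single term, with sign `(-1) ^ N`.
    rw [Matrix.det_succ_row _ (Fin.last N), Fin.sum_univ_succ, sum_eq_zero, add_zero]
    · have h1 : clearedMatrix η (Fin.snoc l (-ξ 0) : Fin (N + 1) → ℂ) ξ (Fin.last N) 0 =
          ∏ j, crossWeight η (Fin.tail ξ j) (-ξ 0) := by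
        simp [clearedMatrix, prod_erase_eq_prod_ite, Fin.prod_univ_succ, Fin.tail, Fin.succ_ne_zero]
      have h2 : (clearedMatrix η (Fin.snoc l (-ξ 0) : Fin (N + 1) → ℂ) ξ).submatrix
          (Fin.last N).succAbove (Fin.succAbove 0) = Matrix.of fun i j =>
          crossWeight η (ξ 0) (l i) * clearedMatrix η l (Fin.tail ξ) i j := by
        ext i j
        simp [clearedMatrix, prod_erase_eq_prod_ite, Fin.prod_univ_succ, Fin.tail,
          (Fin.succ_ne_zero _).symm]
      rw [h1, h2, Matrix.det_mul_column]
      simp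
    · intro j _
      have : clearedMatrix η (Fin.snoc l (-ξ 0) : Fin (N + 1) → ℂ) ξ (Fin.last N) j.succ = 0 := by
        simp only [clearedMatrix, Matrix.of_apply, Fin.snoc_last]
        exact prod_eq_zero (i := 0) (by simp [(Fin.succ_ne_zero j).symm]) (by simp [crossWeight])
      rw [this]; ring
  rw [ClearedFormula] at h ⊢
  rw [partitionFn_freeze hθ, hdet, columnVandermonde_succ, rowVandermonde_snoc, formulaConst,
    Fin.prod_univ_castSucc, Fin.prod_univ_succ (f := fun j => boundaryFactor η δ ζ (ξ j))]
  simp only [Fin.snoc_castSucc, Fin.snoc_last, cosh_sub_cosh_row]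
  have p₁ : (∏ i, sinh (l i + ξ 0 + η) * sinh (l i - ξ 0)) *
      ∏ i, sinh (-ξ 0 - l i) * sinh (-ξ 0 + l i + η) =
      (-1) ^ N * ∏ i, crossWeight η (ξ 0) (l i) := by
    rw [← prod_mul_distrib, ← Fin.prod_const, ← prod_mul_distrib]
    refine prod_congr rfl fun i _ => ?_
    rw [crossWeight, show -ξ 0 - l i = -(l i + ξ 0) by ring,
      show -ξ 0 + l i + η = l i - ξ 0 + η by ring, sinh_neg]
    ring
  have p₂ : (∏ j, sinh (-ξ 0 - Fin.tail ξ j + η) * sinh (-ξ 0 + Fin.tail ξ j + η)) *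
      ∏ j, sinh (Fin.tail ξ j + ξ 0) * sinh (Fin.tail ξ j - ξ 0) =
      (-1) ^ N * ∏ j, crossWeight η (Fin.tail ξ j) (-ξ 0) := by
    rw [← prod_mul_distrib, ← Fin.prod_const, ← prod_mul_distrib]
    refine prod_congr rfl fun j _ => ?_
    rw [crossWeight, show -ξ 0 - Fin.tail ξ j = -(Fin.tail ξ j + ξ 0) by ring,
      show -ξ 0 + Fin.tail ξ j = Fin.tail ξ j - ξ 0 by ring, sinh_neg]
    ring
  change _ = _ * (_ * ∏ j, boundaryFactor η δ ζ (Fin.tail ξ j)) * _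
  generalize ∏ i, sinh (l i + ξ 0 + η) * sinh (l i - ξ 0) = P₁,
    ∏ i, sinh (-ξ 0 - l i) * sinh (-ξ 0 + l i + η) = W, ∏ i, crossWeight η (ξ 0) (l i) = X₁,
    ∏ j, sinh (-ξ 0 - Fin.tail ξ j + η) * sinh (-ξ 0 + Fin.tail ξ j + η) = A,
    ∏ j, sinh (Fin.tail ξ j + ξ 0) * sinh (Fin.tail ξ j - ξ 0) = V,
    ∏ j, crossWeight η (Fin.tail ξ j) (-ξ 0) = X₂,
    ∏ j, boundaryFactor η δ ζ (Fin.tail ξ j) = F, ∏ i, sinh (2 * l i) = L,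
    partitionFn η (δ - ζ) (boundaryWeight δ ζ) l (Fin.tail ξ) (fun _ => 1) (fun _ => 0) = Z,
    ∏ k ∈ range N, sinh (δ - ζ - η * (N - 2 * (k + 1 : ℕ)) - η) /
      sinh (δ - ζ - η * (N - 2 * (k + 1 : ℕ))) = R,
    sinh (δ - ζ - η * N - η) / sinh (δ - ζ - η * N) = r, sinh (2 * -ξ 0) = p at *
  linear_combination
    (R * p * r * boundaryFactor η δ ζ (ξ 0) * A * V * Z * columnVandermonde (Fin.tail ξ) *
      rowVandermonde η l) * p₁ +
    (R * p * r * boundaryFactor η δ ζ (ξ 0) * (-1) ^ N * X₁ * Z *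
      columnVandermonde (Fin.tail ξ) * rowVandermonde η l) * p₂ +
    (R * p * r * boundaryFactor η δ ζ (ξ 0) * (-1) ^ N * X₁ * (-1) ^ N * X₂) * h

/-! ### Interpolation in the last spectral parameter. -/

theorem exists_polynomial_crossWeight (η x : ℂ) : ∃ D : ℂ[X], D.natDegree ≤ 2 ∧
    ∀ l, crossWeight η x l = D.eval (cosh (2 * l + η)) := by
  refine ⟨C (1 / 4) * ((X - C (cosh (2 * x - η))) * (X - C (cosh (2 * x + η)))),
    (natDegree_C_mul_le _ _).trans ?_, fun l => ?_⟩
  · exact natDegree_mul_le_of_le (m := 1) (n := 1) (by compute_degree) (by compute_degree)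
  · have h₁ := cosh_add_sub_cosh_sub (l + x) (l - x + η)
    have h₂ := cosh_add_sub_cosh_sub (l - x) (l + x + η)
    rw [show l + x + (l - x + η) = 2 * l + η by ring,
      show l + x - (l - x + η) = 2 * x - η by ring] at h₁
    rw [show l - x + (l + x + η) = 2 * l + η by ring, ← cosh_neg (l - x - (l + x + η)),
      show -(l - x - (l + x + η)) = 2 * x + η by ring] at h₂
    simp only [eval_mul, eval_C, eval_sub, eval_X]
    rw [h₁, h₂, crossWeight]
    ring

theorem clearedMatrix_minor (η : ℂ) {N : ℕ} (l : Fin N → ℂ) (ξ : Fin (N + 1) → ℂ) (z : ℂ)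
    (j : Fin (N + 1)) :
    (clearedMatrix η (Fin.snoc l z : Fin (N + 1) → ℂ) ξ).submatrix (Fin.last N).succAbove
        j.succAbove =
      Matrix.of fun i k => ∏ m ∈ univ.erase (j.succAbove k), crossWeight η (ξ m) (l i) := by
  ext i k
  simp [clearedMatrix]

/-- As functions of the last spectral parameter, both sides of the cleared formula are polynomials
of degree at most `2 N` in `cosh (2 z + η)`, up to the factor `sinh (2 z)`. -/
theorem ClearedFormula.of_interpolation {η δ ζ : ℂ} {N : ℕ}
    (hθ : RegularHeights η (δ - ζ) (N + 1)) {l : Fin N → ℂ} {ξ : Fin (N + 1) → ℂ}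
    (hinj : Function.Injective fun i =>
      cosh (2 * (Sum.elim (fun j => -ξ j) l : Fin (N + 1) ⊕ Fin N → ℂ) i + η))
    (hξ : ∀ j, sinh (2 * ξ j) ≠ 0)
    (h : ∀ j, ClearedFormula η δ ζ (Fin.snoc l (-ξ j) : Fin (N + 1) → ℂ) ξ) (z : ℂ) :
    ClearedFormula η δ ζ (Fin.snoc l z : Fin (N + 1) → ℂ) ξ := by
  choose Q hQ hQe using exists_polynomial_rowOp hθ ξ
  choose D hD hDe using fun k => exists_polynomial_crossWeight η (ξ k)
  let w : Config (N + 1) → ℂ :=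
    partitionFn η (δ - ζ) (boundaryWeight δ ζ) l ξ (fun _ => 1)
  let G : ℂ[X] := ∑ s, C (w s) * Q s
  let V : ℂ[X] := ∏ i, C (1 / 2) * (X - C (cosh (2 * l i + η)))
  let minor : Fin (N + 1) → ℂ := fun j =>
    (Matrix.of fun i k => ∏ m ∈ univ.erase (j.succAbove k), crossWeight η (ξ m) (l i)).det
  let E : ℂ[X] := ∑ j : Fin (N + 1), C ((-1) ^ (N + j : ℕ) * minor j) * ∏ k ∈ univ.erase j, D k
  let c := formulaConst η (δ - ζ) (N + 1) * (∏ i, sinh (2 * l i)) *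
    ∏ j, boundaryFactor η δ ζ (ξ j)
  let v := columnVandermonde ξ * rowVandermonde η l
  have hG : ∀ z, partitionFn η (δ - ζ) (boundaryWeight δ ζ) (Fin.snoc l z : Fin (N + 1) → ℂ) ξ
      (fun _ => 1) (fun _ => 0) = sinh (2 * z) * G.eval (cosh (2 * z + η)) := by
    intro z
    rw [partitionFn_snoc, Matrix.mul_apply, eval_finsetSum, mul_sum]
    refine sum_congr rfl fun s _ => ?_
    rw [hQe, eval_mul, eval_C]
    ring
  have hV : ∀ z, V.eval (cosh (2 * z + η)) =
      ∏ i, (cosh (2 * z + η) / 2 - cosh (2 * l i + η) / 2) := by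
    intro z
    rw [eval_prod]
    refine prod_congr rfl fun i _ => ?_
    simp only [eval_mul, eval_C, eval_sub, eval_X]
    ring
  have hE : ∀ z, (clearedMatrix η (Fin.snoc l z : Fin (N + 1) → ℂ) ξ).det =
      E.eval (cosh (2 * z + η)) := by
    intro z
    rw [Matrix.det_succ_row _ (Fin.last N), eval_finsetSum]
    refine sum_congr rfl fun j _ => ?_
    rw [clearedMatrix_minor, eval_mul, eval_C, eval_prod]
    simp only [clearedMatrix, Matrix.of_apply, Fin.snoc_last, hDe, Fin.val_last, minor]
    ring
  have hiff : ∀ z, ClearedFormula η δ ζ (Fin.snoc l z : Fin (N + 1) → ℂ) ξ ↔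
      sinh (2 * z) * (C v * (G * V) - C c * E).eval (cosh (2 * z + η)) = 0 := by
    intro z
    rw [ClearedFormula, hG, hE, rowVandermonde_snoc, ← hV, Fin.prod_univ_castSucc,
      ← sub_eq_zero]
    simp only [Fin.snoc_castSucc, Fin.snoc_last, eval_sub, eval_mul, eval_C, v, c]
    ring_nf
  have hdeg : (C v * (G * V) - C c * E).natDegree ≤ 2 * N := by
    refine (natDegree_sub_le _ _).trans (max_le ((natDegree_C_mul_le _ _).trans ?_)
      ((natDegree_C_mul_le _ _).trans ?_))
    · have hGd : G.natDegree ≤ N := natDegree_sum_le_of_forall_le _ _ fun s _ =>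
        (natDegree_C_mul_le _ _).trans (hQ s)
      have hVd : V.natDegree ≤ N := by
        refine (natDegree_prod_le _ _).trans ?_
        refine (sum_le_card_nsmul _ _ 1 fun i _ => ?_).trans (by simp)
        exact (natDegree_C_mul_le _ _).trans (natDegree_X_sub_C_le _)
      exact (natDegree_mul_le_of_le hGd hVd).trans (by omega)
    · refine natDegree_sum_le_of_forall_le _ _ fun j _ => (natDegree_C_mul_le _ _).trans ?_
      refine (natDegree_prod_le _ _).trans ?_
      refine (sum_le_card_nsmul _ _ 2 fun k _ => hD k).trans ?_
      simp [mul_comm]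
  -- There are `2 * N + 1` nodes against degree `2 * N`. At `-ξ j` the formula is given and `sinh (2
  -- * z)` can be cancelled; at `l i` the Vandermonde factor vanishes and the determinant has two
  -- equal rows.
  have hzero : C v * (G * V) - C c * E = 0 := by
    refine eq_zero_of_natDegree_lt_card_of_eval_eq_zero _ hinj ?_ ?_
    · rintro (j | i)
      · have h2 : sinh (2 * -ξ j) ≠ 0 := by
          rw [mul_neg, sinh_neg]; exact neg_ne_zero.2 (hξ j)
        exact (mul_eq_zero.1 ((hiff (-ξ j)).1 (h j))).resolve_left h2
      · have h1 : V.eval (cosh (2 * l i + η)) = 0 := by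
          rw [hV]; exact prod_eq_zero (mem_univ i) (sub_self _)
        have h2 : E.eval (cosh (2 * l i + η)) = 0 := by
          rw [← hE]
          refine Matrix.det_zero_of_row_eq (Fin.castSucc_lt_last i).ne ?_
          ext j
          simp [clearedMatrix]
        simp [h1, h2]
    · simp only [Fintype.card_sum, Fintype.card_fin]
      omega
  rw [hiff, hzero, eval_zero, mul_zero]

/-- Conditions on the parameters under which the interpolation argument applies. -/
structure Generic (η : ℂ) {N : ℕ} (l ξ : Fin N → ℂ) : Prop where
  exchange : ∀ i j, i ≠ j → sinh (ξ i - ξ j + η) ≠ 0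
  column : ∀ i j, i ≠ j → sinh (ξ i - ξ j) ≠ 0 ∧ sinh (ξ i + ξ j - η) ≠ 0
  double : ∀ i, sinh (2 * ξ i) ≠ 0
  row : ∀ i j, i ≠ j → sinh (l i - l j) ≠ 0 ∧ sinh (l i + l j + η) ≠ 0
  cross : ∀ i j, sinh (ξ j + l i) ≠ 0 ∧ sinh (l i - ξ j + η) ≠ 0

theorem Generic.tail {η : ℂ} {N : ℕ} {l : Fin N → ℂ} {z : ℂ} {ξ : Fin (N + 1) → ℂ}
    (h : Generic η (Fin.snoc l z : Fin (N + 1) → ℂ) ξ) : Generic η l (Fin.tail ξ) where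
  exchange _ _ hij := h.exchange _ _ ((Fin.succ_injective _).ne hij)
  column _ _ hij := h.column _ _ ((Fin.succ_injective _).ne hij)
  double _ := h.double _
  row i j hij := by simpa using h.row _ _ ((Fin.castSucc_injective _).ne hij)
  cross i j := by simpa [Fin.tail] using h.cross i.castSucc j.succ

theorem Generic.comp {η : ℂ} {N : ℕ} {l ξ : Fin N → ℂ} (h : Generic η l ξ)
    (σ : Equiv.Perm (Fin N)) : Generic η l (ξ ∘ σ) where
  exchange _ _ hij := h.exchange _ _ (σ.injective.ne hij)
  column _ _ hij := h.column _ _ (σ.injective.ne hij)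
  double _ := h.double _
  row := h.row
  cross i j := h.cross i (σ j)

/-- Differences of nodes factor as `sinh (a - b) * sinh (a + b + η)`, up to the constant 2; the
fields of `Generic` exclude the zeros of these factors. -/
theorem Generic.injective {η : ℂ} {N : ℕ} {l : Fin N → ℂ} {z : ℂ} {ξ : Fin (N + 1) → ℂ}
    (h : Generic η (Fin.snoc l z : Fin (N + 1) → ℂ) ξ) : Function.Injective fun i =>
      cosh (2 * (Sum.elim (fun j => -ξ j) l : Fin (N + 1) ⊕ Fin N → ℂ) i + η) := by
  have key : ∀ a b : ℂ, sinh (a - b) ≠ 0 → sinh (a + b + η) ≠ 0 →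
      cosh (2 * a + η) ≠ cosh (2 * b + η) := by
    intro a b h₁ h₂ hab
    have := cosh_sub_cosh_row η a b
    rw [hab, sub_self] at this
    exact mul_ne_zero h₁ h₂ this.symm
  have hcross : ∀ i j, cosh (2 * -ξ j + η) ≠ cosh (2 * l i + η) := by
    intro i j
    obtain ⟨h₁, h₂⟩ := h.cross i.castSucc j
    rw [Fin.snoc_castSucc] at h₁ h₂
    refine key _ _ ?_ ?_
    · rw [show -ξ j - l i = -(ξ j + l i) by ring, sinh_neg]; exact neg_ne_zero.2 h₁
    · rwa [show -ξ j + l i + η = l i - ξ j + η by ring]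
  rintro (i | i) (j | j) hij
  · by_contra hne
    obtain ⟨h₁, h₂⟩ := h.column i j fun e => hne (by rw [e])
    refine key (-ξ i) (-ξ j) ?_ ?_ hij
    · rw [show -ξ i - -ξ j = -(ξ i - ξ j) by ring, sinh_neg]; exact neg_ne_zero.2 h₁
    · rw [show -ξ i + -ξ j + η = -(ξ i + ξ j - η) by ring, sinh_neg]; exact neg_ne_zero.2 h₂
  · exact absurd hij (hcross j i)
  · exact absurd hij.symm (hcross i j)
  · by_contra hne
    obtain ⟨h₁, h₂⟩ := h.row i.castSucc j.castSucc fun e =>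
      hne (by rw [Fin.castSucc_injective _ e])
    rw [Fin.snoc_castSucc, Fin.snoc_castSucc] at h₁ h₂
    exact key (l i) (l j) h₁ h₂ hij

theorem Generic.clearedFormula {η δ ζ : ℂ} {N : ℕ} (hθ : RegularHeights η (δ - ζ) N)
    {l ξ : Fin N → ℂ} (h : Generic η l ξ) : ClearedFormula η δ ζ l ξ := by
  induction N with
  | zero =>
    simp [ClearedFormula, partitionFn, columnVandermonde, rowVandermonde, formulaConst,
      Matrix.one_apply, eq_iff_true_of_subsingleton]
  | succ N ih =>
    rw [← Fin.snoc_init_self l] at h ⊢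
    refine ClearedFormula.of_interpolation hθ h.injective h.double (fun j => ?_) _
    -- Freezing works only for the leftmost column, so symmetry first moves `ξ j` there.
    refine ClearedFormula.of_perm hθ h.exchange (Equiv.swap 0 j) ?_
    have := ClearedFormula.snoc_freeze hθ (ih (hθ.mono N.le_succ) (h.comp (Equiv.swap 0 j)).tail)
    simpa using this

/-! ### Removal of genericity by continuity in the inhomogeneities. -/

theorem continuous_partitionFn {X : Type*} [TopologicalSpace X] (η δ ζ : ℂ) {M N : ℕ}
    (l : Fin M → ℂ) {ξ : X → Fin N → ℂ} (hξ : Continuous ξ) (s t : Config N) :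
    Continuous fun x => partitionFn η (δ - ζ) (boundaryWeight δ ζ) l (ξ x) s t := by
  induction M generalizing s with
  | zero => simpa [partitionFn] using continuous_const
  | succ M ih =>
    simp only [partitionFn_succ, Matrix.mul_apply]
    exact continuous_finsetSum _ fun u _ =>
      (continuous_rowOp η _ continuous_const continuous_const hξ 0 1 s u).mul (ih _ u)

theorem clearedFormula {η δ ζ : ℂ} {N : ℕ} (hθ : RegularHeights η (δ - ζ) N) {l : Fin N → ℂ}
    (hl : ∀ i j, i ≠ j → sinh (l i - l j) ≠ 0 ∧ sinh (l i + l j + η) ≠ 0) (ξ : Fin N → ℂ) :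
    ClearedFormula η δ ζ l ξ := by
  -- The slopes `j + 1` are distinct and positive. Every argument of `sinh` in `Generic` that
  -- involves `ξ` is thus nonconstant and affine in `t`, hence nonzero for small `t ≠ 0`.
  let ξt : ℂ → Fin N → ℂ := fun t j => ξ j + ((j : ℕ) + 1 : ℂ) * t
  have hξt : Continuous ξt := by fun_prop
  have hgen : ∀ᶠ t in 𝓝[≠] 0, Generic η l (ξt t) := by
    have hdiff : ∀ i j : Fin N, i ≠ j → ((i : ℕ) : ℂ) - (j : ℕ) ≠ 0 := by
      intro i j hij
      rw [sub_ne_zero]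
      exact_mod_cast fun e => hij (Fin.ext e)
    have hsum : ∀ i j : Fin N, ((i : ℕ) : ℂ) + (j : ℕ) + 2 ≠ 0 := by
      intro i j
      exact_mod_cast Nat.succ_ne_zero ((i : ℕ) + j + 1)
    have hone : ∀ i : Fin N, ((i : ℕ) : ℂ) + 1 ≠ 0 := fun i => Nat.cast_add_one_ne_zero _
    have ev : ∀ (a b : ℂ) (f : ℂ → ℂ), a ≠ 0 → (∀ t, f t = a * t + b) →
        ∀ᶠ t in 𝓝[≠] 0, sinh (f t) ≠ 0 := by
      intro a b f ha hf
      simp only [hf]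
      exact eventually_sinh_ne_zero ha b 0
    have g₁ : ∀ᶠ t in 𝓝[≠] 0, ∀ i j, i ≠ j → sinh (ξt t i - ξt t j + η) ≠ 0 := by
      simp only [eventually_all]
      intro i j hij
      exact ev _ (ξ i - ξ j + η) _ (hdiff i j hij) fun t => by simp only [ξt]; ring
    have g₂ : ∀ᶠ t in 𝓝[≠] 0, ∀ i j, i ≠ j → sinh (ξt t i - ξt t j) ≠ 0 := by
      simp only [eventually_all]
      intro i j hij
      exact ev _ (ξ i - ξ j) _ (hdiff i j hij) fun t => by simp only [ξt]; ring
    have g₃ : ∀ᶠ t in 𝓝[≠] 0, ∀ i j, sinh (ξt t i + ξt t j - η) ≠ 0 := by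
      simp only [eventually_all]
      intro i j
      exact ev _ (ξ i + ξ j - η) _ (hsum i j) fun t => by simp only [ξt]; ring
    have g₄ : ∀ᶠ t in 𝓝[≠] 0, ∀ i, sinh (2 * ξt t i) ≠ 0 := by
      simp only [eventually_all]
      intro i
      exact ev _ (2 * ξ i) _ (mul_ne_zero two_ne_zero (hone i)) fun t => by simp only [ξt]; ring
    have g₅ : ∀ᶠ t in 𝓝[≠] 0, ∀ i j, sinh (ξt t j + l i) ≠ 0 := by
      simp only [eventually_all]
      intro i j
      exact ev _ (ξ j + l i) _ (hone j) fun t => by simp only [ξt]; ring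
    have g₆ : ∀ᶠ t in 𝓝[≠] 0, ∀ i j, sinh (l i - ξt t j + η) ≠ 0 := by
      simp only [eventually_all]
      intro i j
      exact ev _ (l i - ξ j + η) _ (neg_ne_zero.2 (hone j)) fun t => by simp only [ξt]; ring
    filter_upwards [g₁, g₂, g₃, g₄, g₅, g₆] with t h₁ h₂ h₃ h₄ h₅ h₆
    exact ⟨h₁, fun i j hij => ⟨h₂ i j hij, h₃ i j⟩, h₄, hl, fun i j => ⟨h₅ i j, h₆ i j⟩⟩
  have h0 : ξt 0 = ξ := by ext; simp [ξt]
  rw [← h0]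
  refine eq_of_eventually_eq_punctured
    (f := fun t => partitionFn η (δ - ζ) (boundaryWeight δ ζ) l (ξt t) (fun _ => 1) (fun _ => 0) *
      (columnVandermonde (ξt t) * rowVandermonde η l))
    (g := fun t => formulaConst η (δ - ζ) N * (∏ i, sinh (2 * l i)) *
      (∏ j, boundaryFactor η δ ζ (ξt t j)) * (clearedMatrix η l (ξt t)).det) ?_ ?_
    (hgen.mono fun t ht => ht.clearedFormula hθ)
  · have h₁ := continuous_partitionFn η δ ζ l hξt (fun _ => 1) (fun _ => 0)
    have h₂ : Continuous fun t => columnVandermonde (ξt t) := by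
      simp only [columnVandermonde, Matrix.det_vandermonde]
      fun_prop
    exact (h₁.mul (h₂.mul continuous_const)).continuousAt
  · have h₁ : Continuous fun t => (clearedMatrix η l (ξt t)).det := by
      refine Continuous.matrix_det (continuous_matrix fun i j => ?_)
      simp only [clearedMatrix, Matrix.of_apply, crossWeight]
      fun_prop
    have h₂ : Continuous fun t => ∏ j, boundaryFactor η δ ζ (ξt t j) := by
      simp only [boundaryFactor]
      fun_prop
    exact ((continuous_const.mul h₂).mul h₁).continuousAt

/-! ### Return to the original normalisation. -/

theorem partitionB_eq {η δ ζ : ℂ} {N : ℕ} {l ξ : Fin N → ℂ} (hδ : ∀ i, sinh (δ + l i) ≠ 0)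
    (hζ : ∀ i, sinh (ζ + l i) ≠ 0) : partitionB η δ ζ l ξ =
      (∏ i, (sinh (δ + l i) * sinh (ζ + l i))⁻¹) *
        partitionFn η (δ - ζ) (boundaryWeight δ ζ) l ξ (fun _ => 1) (fun _ => 0) := by
  have hB : ∀ i, opB η δ ζ ξ (l i) (δ - ζ) = (sinh (δ + l i) * sinh (ζ + l i))⁻¹ •
      rowOp η (δ - ζ) (l i) (boundaryWeight δ ζ (l i)) N ξ 0 1 := by
    intro i
    rw [← rowOp_smul]
    ext s t
    rw [opB, Matrix.of_apply, doubleRow_eq_rowOp]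
    congr 1
    have h₁ := hδ i
    have h₂ := hζ i
    ext c
    fin_cases c
    · simp [boundaryK, boundaryWeight]; field_simp
    · simp [boundaryK, boundaryWeight]; field_simp
  have smul_prod : ∀ (M : ℕ) (r : Fin M → ℂ) (A : Fin M → Matrix (Config N) (Config N) ℂ),
      (List.ofFn fun i => r i • A i).prod = (∏ i, r i) • (List.ofFn A).prod := by
    intro M r A
    induction M with
    | zero => simp
    | succ M ih =>
      simp only [List.ofFn_succ, List.prod_cons, ih, Fin.prod_univ_succ]
      rw [Matrix.smul_mul, Matrix.mul_smul, smul_smul]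
  simp only [partitionB, hB, smul_prod]
  rfl

/-- The numerator products run over heights in steps of `2 * η`. The factor added by one recursion
step is the quotient of two successive ones, corrected by `sinh (θ + η * N)`, which is the new
factor of the denominator. The signs accumulate to `0 + 1 + ⋯ + (N - 1) = N.choose 2`. -/
theorem formulaConst_eq {η θ : ℂ} {N : ℕ} (hθ : RegularHeights η θ N) :
    formulaConst η θ N = (-1) ^ N.choose 2 * ∏ i ∈ Icc 1 N,
      sinh (θ + η * ((N : ℂ) - 2 * (i : ℂ))) / sinh (θ + η * ((N : ℂ) - (i : ℂ))) := by
  have num : ∀ N : ℕ, ∏ i ∈ Icc 1 N, sinh (θ + η * ((N : ℂ) - 2 * (i : ℂ))) =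
      ∏ k ∈ range N, sinh (θ + η * (2 * (k : ℂ) - N)) := by
    intro N
    rw [← prod_range_reflect, range_eq_Ico, ← Ico_add_one_right_eq_Icc,
      ← prod_Ico_add' _ 0 N 1]
    refine prod_congr rfl fun k hk => ?_
    have hk' : k + 1 ≤ N := (mem_Ico.1 hk).2
    rw [Nat.sub_sub, Nat.cast_sub (by omega)]
    congr 3
    push_cast
    ring
  have den : ∀ N : ℕ, ∏ i ∈ Icc 1 N, sinh (θ + η * ((N : ℂ) - (i : ℂ))) =
      ∏ k ∈ range N, sinh (θ + η * (k : ℂ)) := by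
    intro N
    rw [← prod_range_reflect, range_eq_Ico, ← Ico_add_one_right_eq_Icc,
      ← prod_Ico_add' _ 0 N 1]
    refine prod_congr rfl fun k hk => ?_
    have hk' : k + 1 ≤ N := (mem_Ico.1 hk).2
    rw [Nat.sub_sub, Nat.cast_sub (by omega)]
    congr 3
    push_cast
    ring
  induction N with
  | zero => simp [formulaConst]
  | succ N ih =>
    have hnum : ∏ k ∈ range (N + 1), sinh (θ + η * (2 * (k : ℂ) - (N + 1 : ℕ))) =
        (∏ k ∈ range N, sinh (θ - η * (N - 2 * (k + 1 : ℕ)) - η)) * sinh (θ - η * N - η) := by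
      rw [prod_range_succ']
      congr 1
      · refine prod_congr rfl fun k _ => ?_
        congr 1; push_cast; ring
      · congr 1; push_cast; ring
    -- Both sides are the product over `θ + η * (2 * k - N)` with `0 ≤ k ≤ N`, with the last factor
    -- split off on the left and the first one on the right.
    have hden : (∏ k ∈ range N, sinh (θ + η * (2 * (k : ℂ) - N))) * sinh (θ + η * N) =
        (∏ k ∈ range N, sinh (θ - η * (N - 2 * (k + 1 : ℕ)))) * sinh (θ - η * N) := by
      have h := prod_range_succ (fun k : ℕ => sinh (θ + η * (2 * (k : ℂ) - N))) N
      rw [prod_range_succ'] at h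
      convert h.symm using 2
      · congr 1; ring
      · refine prod_congr rfl fun k _ => ?_
        congr 1; push_cast; ring
      · congr 1; push_cast; ring
    have hne : ∀ k : ℤ, |k| ≤ N → sinh (θ + η * (k : ℂ)) ≠ 0 := fun k hk =>
      hθ k (by push_cast; omega)
    have n₁ : ∏ k ∈ range N, sinh (θ + η * (2 * (k : ℂ) - N)) ≠ 0 := by
      refine prod_ne_zero_iff.2 fun k hk => ?_
      have := hne (2 * k - N) (by rw [abs_le]; have := mem_range.1 hk; omega)
      push_cast at this
      exact this
    have n₂ : sinh (θ + η * N) ≠ 0 := by simpa using hne N (by simp)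
    have n₃ : (∏ k ∈ range N, sinh (θ - η * (N - 2 * (k + 1 : ℕ)))) * sinh (θ - η * N) ≠ 0 :=
      hden ▸ mul_ne_zero n₁ n₂
    have n₄ : ∏ k ∈ range N, sinh (θ + η * (k : ℂ)) ≠ 0 := by
      refine prod_ne_zero_iff.2 fun k hk => ?_
      have := hne k (by rw [abs_le]; have := mem_range.1 hk; omega)
      push_cast at this
      exact this
    have n₅ := left_ne_zero_of_mul n₃
    have n₆ := right_ne_zero_of_mul n₃
    rw [formulaConst, ih (hθ.mono N.le_succ), Nat.choose_succ_succ' N 1, Nat.choose_one_right,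
      pow_add, prod_div_distrib, prod_div_distrib, prod_div_distrib, num, num, den, den, hnum,
      prod_range_succ (fun k : ℕ => sinh (θ + η * (k : ℂ)))]
    generalize ∏ k ∈ range N, sinh (θ + η * (2 * (k : ℂ) - N)) = A,
      ∏ k ∈ range N, sinh (θ + η * (k : ℂ)) = D,
      ∏ k ∈ range N, sinh (θ - η * (N - 2 * (k + 1 : ℕ)) - η) = P,
      ∏ k ∈ range N, sinh (θ - η * (N - 2 * (k + 1 : ℕ))) = R, sinh (θ + η * N) = p,
      sinh (θ - η * N) = q, sinh (θ - η * N - η) = r at *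
    field_simp
    linear_combination (P * r) * hden

/-- Multiplying row `i` by all its cross weights cancels the denominator of each entry and leaves
the product over the other columns. The remaining prefactors depend on the row or the column alone.
-/
theorem det_detMatrix {η δ ζ : ℂ} {N : ℕ} {l ξ : Fin N → ℂ}
    (hlξ : ∀ i j, crossWeight η (ξ j) (l i) ≠ 0) :
    (detMatrix η δ ζ l ξ).det * ∏ i, ∏ j, crossWeight η (ξ j) (l i) =
      (∏ i, sinh (2 * l i)) * (∏ i, (sinh (δ + l i) * sinh (ζ + l i))⁻¹) *
        (∏ j, boundaryFactor η δ ζ (ξ j)) * (clearedMatrix η l ξ).det := by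
  rw [mul_comm, ← Matrix.det_mul_column, ← prod_mul_distrib, mul_assoc, ← Matrix.det_mul_row,
    ← Matrix.det_mul_column]
  congr 1
  ext i j
  have h := hlξ i j
  simp only [Matrix.of_apply, clearedMatrix, detMatrix, boundaryFactor]
  rw [← mul_prod_erase univ (fun k => crossWeight η (ξ k) (l i)) (mem_univ j)]
  generalize ∏ k ∈ univ.erase j, crossWeight η (ξ k) (l i) = P
  have e : sinh (l i - ξ j + η) * sinh (l i + ξ j + η) * sinh (l i - ξ j) * sinh (l i + ξ j) =
      crossWeight η (ξ j) (l i) := by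
    rw [crossWeight]; ring
  rw [e]
  generalize crossWeight η (ξ j) (l i) = c at h
  field_simp

end SOSReflecting

/-- Determinant formula for the partition function of the trigonometric SOS model with a left
reflecting end and domain wall boundary conditions. The hypotheses say that no denominator in
the operators `B_-(l i; δ - ζ)` and in the formula vanishes. -/
theorem mainTheorem1 (N : ℕ) (η δ ζ : ℂ) (l ξ : Fin N → ℂ)
    (hθ : ∀ k : ℤ, |k| < (N : ℤ) → Complex.sinh (δ - ζ + η * (k : ℂ)) ≠ 0)
    (hδ : ∀ i, Complex.sinh (δ + l i) ≠ 0)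
    (hζ : ∀ i, Complex.sinh (ζ + l i) ≠ 0)
    (hlξ : ∀ i j, Complex.sinh (l i - ξ j) ≠ 0 ∧ Complex.sinh (l i + ξ j) ≠ 0 ∧
      Complex.sinh (l i - ξ j + η) ≠ 0 ∧ Complex.sinh (l i + ξ j + η) ≠ 0)
    (hξ : ∀ i j, i < j → Complex.sinh (ξ j - ξ i) ≠ 0 ∧ Complex.sinh (ξ j + ξ i) ≠ 0)
    (hl : ∀ i j, i < j → Complex.sinh (l j - l i) ≠ 0 ∧ Complex.sinh (l j + l i + η) ≠ 0) :
    SOSReflecting.partitionB η δ ζ l ξ =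
      (-1 : ℂ) ^ (N.choose 2) * (SOSReflecting.detMatrix η δ ζ l ξ).det *
        (∏ i ∈ Finset.Icc 1 N,
          Complex.sinh (δ - ζ + η * ((N : ℂ) - 2 * (i : ℂ))) /
            Complex.sinh (δ - ζ + η * ((N : ℂ) - (i : ℂ)))) *
        ((∏ i : Fin N, ∏ j : Fin N,
            Complex.sinh (l i + ξ j) * Complex.sinh (l i - ξ j) *
              Complex.sinh (l i + ξ j + η) * Complex.sinh (l i - ξ j + η)) /
          ∏ i : Fin N, ∏ j ∈ Finset.Ioi i,
            Complex.sinh (ξ j + ξ i) * Complex.sinh (ξ j - ξ i) *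
              Complex.sinh (l j - l i) * Complex.sinh (l j + l i + η)) := by
  have hl' : ∀ i j, i ≠ j →
      Complex.sinh (l i - l j) ≠ 0 ∧ Complex.sinh (l i + l j + η) ≠ 0 := by
    intro i j hij
    rcases hij.lt_or_gt with h | h
    · rw [← neg_sub, Complex.sinh_neg, add_comm (l i)]
      exact ⟨neg_ne_zero.2 (hl i j h).1, (hl i j h).2⟩
    · exact hl j i h
  have hF : SOSReflecting.ClearedFormula η δ ζ l ξ := SOSReflecting.clearedFormula hθ hl' ξ
  have hden : ∏ i : Fin N, ∏ j ∈ Finset.Ioi i, Complex.sinh (ξ j + ξ i) *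
      Complex.sinh (ξ j - ξ i) * Complex.sinh (l j - l i) * Complex.sinh (l j + l i + η) =
      SOSReflecting.columnVandermonde ξ * SOSReflecting.rowVandermonde η l := by
    simp only [SOSReflecting.columnVandermonde, SOSReflecting.rowVandermonde,
      Matrix.det_vandermonde, ← Finset.prod_mul_distrib, SOSReflecting.cosh_sub_cosh_row]
    refine Finset.prod_congr rfl fun i _ => Finset.prod_congr rfl fun j _ => ?_
    have h := SOSReflecting.cosh_sub_cosh_row 0 (ξ j) (ξ i)
    simp only [add_zero] at h
    rw [h]
    ring
  have hne : SOSReflecting.columnVandermonde ξ * SOSReflecting.rowVandermonde η l ≠ 0 := by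
    rw [← hden]
    refine Finset.prod_ne_zero_iff.2 fun i _ => Finset.prod_ne_zero_iff.2 fun j hj => ?_
    have hij := Finset.mem_Ioi.1 hj
    exact mul_ne_zero (mul_ne_zero (mul_ne_zero (hξ i j hij).2 (hξ i j hij).1) (hl i j hij).1)
      (hl i j hij).2
  have hdet := SOSReflecting.det_detMatrix (η := η) (δ := δ) (ζ := ζ) (l := l) (ξ := ξ)
    fun i j => mul_ne_zero (mul_ne_zero (mul_ne_zero (hlξ i j).2.1 (hlξ i j).1)
      (hlξ i j).2.2.2) (hlξ i j).2.2.1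
  rw [SOSReflecting.ClearedFormula, SOSReflecting.formulaConst_eq hθ] at hF
  simp only [SOSReflecting.crossWeight] at hdet
  rw [SOSReflecting.partitionB_eq hδ hζ, hden, ← mul_div_assoc, eq_div_iff hne]
  linear_combination (∏ i, (Complex.sinh (δ + l i) * Complex.sinh (ζ + l i))⁻¹) * hF -
    ((-1 : ℂ) ^ (N.choose 2) * ∏ i ∈ Finset.Icc 1 N,
      Complex.sinh (δ - ζ + η * ((N : ℂ) - 2 * (i : ℂ))) /
        Complex.sinh (δ - ζ + η * ((N : ℂ) - (i : ℂ)))) * hdet
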